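/- Let $n\ge 2$ and $\kappa\in\mathbb R$. Put $S_\kappa(t)=\sinh(\sqrt{-\kappa}\,t)/\sqrt{-\kappa}$, $t$, $\sin(\sqrt{\kappa}\,t)/\sqrt{\kappa}$ according as $\kappa<0$, $\kappa=0$, $\kappa>0$, and let $a=\infty$ if $\kappa\le 0$, $a=\pi/\sqrt\kappa$ if $\kappa>0$. Let $B=\{x\in\mathbb R^n: |x|<a\}$ (so $B=\mathbb R^n$ if $\kappa\le 0$). For a function $f$ smooth on $[0,a)$, positive on $(0,a)$, with $f(0)=0$, $f'(0)=1$, let $g_f=dt^2+f(t)^2d\theta^2$ be the corresponding rotationally symmetric metric on $B=[0,a)\times\mathbb S^{n-1}$ (polar coordinates $x=t\theta$), let $H_f(x)$ be the mean curvature at $x\neq0$ of the sphere about the origin through $x$ with respect to the unit normal $-\partial_t$, let $K_f(x)(\partial_t,v)$ ($v\perp\partial_t$, $v\ne0$) be the radial sectional curvatures, and put $\psi_f=-f'S_\kappa+fS_\kappa'$. The case $f=S_\kappa$ is the model metric of constant curvature $\kappa$, whose spheres have mean curvature $H_{S_\kappa}=(n-1)S_\kappa'/S_\kappa$; the metric $g_{S_\kappa}$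 is smooth on $B$. (1) For every $f$ as above, $g_f$ is a Riemannian metric that is smooth on $B\setminus\{0\}$ and continuous on $B$, and it is smooth on $B$ if $f$ extends to a smooth odd function on $(-a,a)$. The $g_f$-distance in $B$ from the origin to $x$ is $|x|$. Moreover $\psi_f(0)=\psi_f'(0)=0$, and $$f(t)=S_\kappa(t)-S_\kappa(t)\int_0^t\frac{\psi_f(s)}{S_\kappa(s)^2}\,ds\qquad(0\le t<a).$$ At each $x\in B\setminus\{0\}$ with $t=|x|$: $K_f(x)(\partial_t,v)\le\kappa$ if and only if $\psi_f'(t)\le 0$ (for each $v\perp\partial_t$, $v\neq 0$); $H_f(x)=(n-1)f'(t)/f(t)$; and $H_f(x)\ge H_{S_\kappa}(x)$ if and only if $\psi_f(t)\le 0$. (2) Let $t_0>0$ (for instance $t_0=1$) and let $\psi:[0,a)\to\mathbb R$ be smooth with $\psi(0)=\psi'(0)=0$, $\psi\le0$ on $[0,a)$, and $\psi'(t)>0$ for $t_0<t<a$. Then $\psi/S_\kappa^2$ is integrable on $[0,t]$ for every $t<a$, and $f=S_\kappa-S_\kappa\int_0^t\psi/S_\kappa^2$ is smooth on $[0,a)$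 and positive on $(0,a)$ with $f(0)=0$, $f'(0)=1$ and $\psi_f=\psi$. If $\psi$ extends to a smooth odd function on $(-a,a)$, then $g_f$ is smooth on $B$. In every case all radial sectional curvatures of $g_f$ exceed $\kappa$ at every $x\in B$ with $|x|>t_0$, while $H_f\ge H_{S_\kappa}$ on all of $B\setminus\{0\}$, that is, $(n-1)f'/f\ge(n-1)S_\kappa'/S_\kappa$ on $(0,a)$. (3) For every $t_0\in(0,a)$ there is a smooth odd function $f:\mathbb R\to\mathbb R$ with $f'(0)=1$ and $f>0$ on $(0,\infty)$ such that $\psi_f$, restricted to $[0,a)$, satisfies the conditions on $\psi$ in (2), and such that $g_f$ is a complete smooth Riemannian metric on all of $\mathbb R^n$, the $g_f$-distance from the origin to $x$ being $|x|$ for all $x \in \mathbb R^n$. For this metric all radial sectional curvatures exceed $\kappa$ at every $x\in B$ with $|x|>t_0$ (for $\kappa\le 0$: outside the compact ball $\{|x|\le t_0\}$ of $\mathbb R^n$), and $H_f\ge H_{S_\kappa}$ on all of $B\setminus\{0\}$. In particular, on every ball $B(0,r)$ with $t_0<r<a$ the mean curvature comparison $H_f\ge H_{S_\kappa}$ holds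 everywhere (except at the origin, where it is not defined). The upper sectional curvature bound $K\le\kappa$, on the other hand, fails on every ball $B(0,r)$ with $r>t_0$. In this sense the eigenvalue comparison theorem under the hypothesis $H\ge H_{S_\kappa}$ on distance spheres strictly extends Cheng's theorem, which assumes $K\le\kappa$. -/

import Mathlib

open Set Filter Topology MeasureTheory
open scoped ContDiff ENNReal

noncomputable section

/-! ## Riemannian metrics on open subsets of `ℝⁿ` -/

/-- Euclidean `n`-space. -/
abbrev Euc (n : ℕ) := EuclideanSpace ℝ (Fin n)

/-- The `i`-th standard basis vector of `ℝⁿ`. -/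
def stdVec {n : ℕ} (i : Fin n) : Euc n := EuclideanSpace.single i (1 : ℝ)

/-- A field of bilinear forms on `ℝⁿ`; `g x v w` is the value at `x` on the vectors `v`, `w`. -/
abbrev BilinField (n : ℕ) := Euc n → Euc n →L[ℝ] Euc n →L[ℝ] ℝ

/-- `g` is a smooth Riemannian metric on `Ω`. -/
structure IsSmoothMetricOn {n : ℕ} (g : BilinField n) (Ω : Set (Euc n)) : Prop where
  smooth : ContDiffOn ℝ ∞ g Ω
  symm : ∀ x ∈ Ω, ∀ v w, g x v w = g x w v
  pos : ∀ x ∈ Ω, ∀ v, v ≠ 0 → 0 < g x v v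

/-- The matrix `(g_{ij})` of the metric in the standard coordinates. -/
def metricMatrix {n : ℕ} (g : BilinField n) (x : Euc n) : Matrix (Fin n) (Fin n) ℝ :=
  Matrix.of fun i j => g x (stdVec i) (stdVec j)

/-- Christoffel symbols of the first kind, `½ (D_u g(v,w) + D_v g(u,w) - D_w g(u,v))`. -/
def christoffelLower {n : ℕ} (g : BilinField n) (x u v w : Euc n) : ℝ :=
  (fderiv ℝ (fun y => g y v w) x u + fderiv ℝ (fun y => g y u w) x v
    - fderiv ℝ (fun y => g y u v) x w) / 2

/-- Christoffel symbols of the second kind: `christoffel g x u v` is `∑ u^i v^j Γ^k_{ij}(x) ∂_k`,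
the Levi-Civita derivative at `x` of the constant field `v` in the direction `u`. -/
def christoffel {n : ℕ} (g : BilinField n) (x u v : Euc n) : Euc n :=
  ∑ k, (∑ l, (metricMatrix g x)⁻¹ k l * christoffelLower g x u v (stdVec l)) • stdVec k

/-- The Levi-Civita covariant derivative `∇_v X` at `x`. -/
def covDeriv {n : ℕ} (g : BilinField n) (X : Euc n → Euc n) (x v : Euc n) : Euc n :=
  fderiv ℝ X x v + christoffel g x v (X x)

/-- The Riemann curvature tensor `R(u,v)w = ∇_u ∇_v w - ∇_v ∇_u w` (constant fields `u, v, w`). -/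
def curvatureTensor {n : ℕ} (g : BilinField n) (x u v w : Euc n) : Euc n :=
  covDeriv g (fun y => christoffel g y v w) x u - covDeriv g (fun y => christoffel g y u w) x v

/-- The sectional curvature of the plane spanned by `u` and `v` at `x`. -/
def sectionalCurvature {n : ℕ} (g : BilinField n) (x u v : Euc n) : ℝ :=
  g x (curvatureTensor g x u v v) u / (g x u u * g x v v - g x u v ^ 2)

/-- The mean curvature (trace of the shape operator `v ↦ -∇_v N` of the tangent space `N^⊥`) at `x`
of the hypersurface through `x` with `g`-unit normal field `N`. The projection
`v ↦ v - g(v,N)N` onto `N^⊥` allows the trace to be taken over the standard basis of `ℝⁿ`. -/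
def meanCurvature {n : ℕ} (g : BilinField n) (N : Euc n → Euc n) (x : Euc n) : ℝ :=
  ∑ i, (-covDeriv g N x (stdVec i - g x (stdVec i) (N x) • N x)) i

/-- The `g`-length of a curve parametrized by `[0,1]`. -/
def curveLength {n : ℕ} (g : BilinField n) (γ : ℝ → Euc n) : ℝ≥0∞ :=
  ∫⁻ t in Icc (0 : ℝ) 1, ENNReal.ofReal
    (√(g (γ t) (derivWithin γ (Icc 0 1) t) (derivWithin γ (Icc 0 1) t)))

/-- The Riemannian distance of `(Ω, g)`: the infimum of the lengths of `C¹` curves in `Ω`. -/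
def metricDist {n : ℕ} (g : BilinField n) (Ω : Set (Euc n)) (x y : Euc n) : ℝ≥0∞ :=
  ⨅ (γ : ℝ → Euc n) (_ : ContDiffOn ℝ 1 γ (Icc 0 1) ∧ MapsTo γ (Icc 0 1) Ω ∧ γ 0 = x ∧ γ 1 = y),
    curveLength g γ

/-- `(ℝⁿ, g)` is complete: Cauchy sequences for the Riemannian distance converge. -/
def IsCompleteMetric {n : ℕ} (g : BilinField n) : Prop :=
  ∀ u : ℕ → Euc n,
    (∀ ε : ℝ≥0∞, 0 < ε → ∃ N, ∀ j ≥ N, ∀ k ≥ N, metricDist g univ (u j) (u k) < ε) →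
    ∃ x, ∀ ε : ℝ≥0∞, 0 < ε → ∃ N, ∀ k ≥ N, metricDist g univ (u k) x < ε

/-! ## Rotationally symmetric metrics -/

/-- The Euclidean inner product as a bilinear form. -/
def euclForm (n : ℕ) : Euc n →L[ℝ] Euc n →L[ℝ] ℝ := innerSL ℝ

theorem euclForm_apply (n : ℕ) (v w : Euc n) : euclForm n v w = inner ℝ v w := rfl

/-- The radial field `∂/∂t = x/|x|`. -/
def radialField {n : ℕ} (x : Euc n) : Euc n := ‖x‖⁻¹ • x

/-- The metric `dt² + f(t)² dθ²` in geodesic polar coordinates `x = tθ` about the origin, written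
in Cartesian coordinates. At the origin it is the Euclidean form. -/
def warpedMetric (n : ℕ) (f : ℝ → ℝ) : BilinField n := fun x =>
  if x = 0 then euclForm n else
    ((f ‖x‖ / ‖x‖) ^ 2) • euclForm n +
      (1 - (f ‖x‖ / ‖x‖) ^ 2) •
        (euclForm n (radialField x)).smulRight (euclForm n (radialField x))

/-- The pull-back of `warpedMetric n f` under `(t, θ) ↦ tθ` is `dt² + f(t)² dθ²`: the vectors
`a ∂_t + w`, `b ∂_t + w'` at `(t, θ)`, with `w, w'` tangent to the unit sphere at `θ`, are mapped to
`aθ + tw`, `bθ + tw'`. -/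
theorem warpedMetric_polar (n : ℕ) (f : ℝ → ℝ) (t : ℝ) (ht : 0 < t) (θ w w' : Euc n) (a b : ℝ)
    (hθ : ‖θ‖ = 1) (hw : inner ℝ θ w = 0) (hw' : inner ℝ θ w' = 0) :
    warpedMetric n f (t • θ) (a • θ + t • w) (b • θ + t • w') =
      a * b + f t ^ 2 * inner ℝ w w' := by
  have hθ0 : θ ≠ 0 := by rintro rfl; simp at hθ
  have hn : ‖t • θ‖ = t := by rw [norm_smul, hθ, mul_one, Real.norm_of_nonneg ht.le]
  have hr : radialField (t • θ) = θ := by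
    rw [radialField, hn, smul_smul, inv_mul_cancel₀ ht.ne', one_smul]
  have hin : inner ℝ θ θ = (1 : ℝ) := by rw [real_inner_self_eq_norm_sq, hθ]; norm_num
  have hw2 : inner ℝ w θ = 0 := by rw [real_inner_comm]; exact hw
  have hne : t • θ ≠ 0 := smul_ne_zero ht.ne' hθ0
  have hin' : ‖θ‖ ^ 2 = 1 := by rw [hθ]; norm_num
  simp only [warpedMetric, if_neg hne, hr, hn]
  simp [euclForm_apply, inner_add_right, inner_smul_right, hw, hw', hw2, hθ]
  field_simp
  ring

/-- `∂/∂t` is a unit field and is normal to the spheres about the origin. -/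
theorem warpedMetric_radialField (n : ℕ) (f : ℝ → ℝ) (x v : Euc n) (hx : x ≠ 0) :
    warpedMetric n f x (radialField x) v = inner ℝ (radialField x) v := by
  have h1 : ‖radialField x‖ = 1 := by
    rw [radialField, norm_smul, norm_inv, norm_norm, inv_mul_cancel₀ (norm_ne_zero_iff.mpr hx)]
  simp only [warpedMetric, if_neg hx]
  simp [euclForm_apply, h1]

/-- The mean curvature at `x` of the sphere about the origin through `x`, with respect to the
unit normal field `-∂/∂t`. -/
def sphereMeanCurvature {n : ℕ} (g : BilinField n) (x : Euc n) : ℝ :=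
  meanCurvature g (fun y => -radialField y) x

/-! ## The model spaces and the comparison function -/

/-- The function `S_κ`. -/
def modelS (κ t : ℝ) : ℝ :=
  if κ < 0 then Real.sinh (√(-κ) * t) / √(-κ)
  else if κ = 0 then t
  else Real.sin (√κ * t) / √κ

/-- The interval `[0, a_κ)` of radii of the model space, where `a_κ = π/√κ` if `κ > 0` and
`a_κ = ∞` if `κ ≤ 0`. -/
def modelInterval (κ : ℝ) : Set ℝ := {t | 0 ≤ t ∧ (0 < κ → √κ * t < Real.pi)}

/-- The open ball of radius `a_κ` about the origin of `ℝⁿ`; all of `ℝⁿ` if `κ ≤ 0`. -/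
def modelBall (n : ℕ) (κ : ℝ) : Set (Euc n) := {x | ‖x‖ ∈ modelInterval κ}

/-- `f` is smooth on `[0, a_κ)`, positive on `(0, a_κ)`, with `f(0) = 0` and `f'(0) = 1`. -/
structure IsWarping (κ : ℝ) (f : ℝ → ℝ) : Prop where
  smooth : ContDiffOn ℝ ∞ f (modelInterval κ)
  zero : f 0 = 0
  deriv_zero : derivWithin f (modelInterval κ) 0 = 1
  pos : ∀ t ∈ modelInterval κ, 0 < t → 0 < f t

/-- `h : [0, a_κ) → ℝ` extends to a smooth odd function on `(-a_κ, a_κ)`. -/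
def HasSmoothOddExtension (κ : ℝ) (h : ℝ → ℝ) : Prop :=
  ∃ H : ℝ → ℝ, ContDiffOn ℝ ∞ H {t | |t| ∈ modelInterval κ} ∧ (∀ t, H (-t) = -H t) ∧
    EqOn H h (modelInterval κ)

/-- `ψ_κ = -f' S_κ + f S_κ'`. -/
def comparisonFn (κ : ℝ) (f : ℝ → ℝ) (t : ℝ) : ℝ :=
  -derivWithin f (modelInterval κ) t * modelS κ t + f t * deriv (modelS κ) t

/-- The function `f = S_κ - S_κ ∫₀ᵗ ψ / S_κ²` with `-f' S_κ + f S_κ' = ψ`, `f(0) = 0`,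
`f'(0) = 1`. -/
def warpingOf (κ : ℝ) (ψ : ℝ → ℝ) (t : ℝ) : ℝ :=
  modelS κ t - modelS κ t * ∫ s in (0 : ℝ)..t, ψ s / modelS κ s ^ 2

/-- `ψ` is a smooth function on `[0, a_κ)` with `ψ(0) = ψ'(0) = 0`, `ψ ≤ 0`, and `ψ' > 0` for
`t > t₀`. -/
structure IsAdmissible (κ t₀ : ℝ) (ψ : ℝ → ℝ) : Prop where
  smooth : ContDiffOn ℝ ∞ ψ (modelInterval κ)
  zero : ψ 0 = 0
  deriv_zero : derivWithin ψ (modelInterval κ) 0 = 0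
  nonpos : ∀ t ∈ modelInterval κ, ψ t ≤ 0
  deriv_pos : ∀ t ∈ modelInterval κ, t₀ < t → 0 < derivWithin ψ (modelInterval κ) t

end

/-!
A rotationally symmetric metric `dt² + f² dθ²` is controlled by one-variable calculus, through
`ψ_f = -f' S_κ + f S_κ'`.

**One variable.** Since `ψ_f' = -S_κ (f'' + κ f)` and `(f / S_κ)' = -ψ_f / S_κ²`, the function `f`
is recovered from `ψ_f` by integration (`eqOn_warpingOf_comparisonFn`, `comparisonFn_warpingOf`).
The singularities at `t = 0` are removed by Hadamard's lemma: `w(t) - w(0) = t ∫₀¹ w'(ts) ds`,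
where the average `radialAverage` of a smooth function is smooth (`contDiffOn_radialAverage`), also
up to the end point of a half-open interval.

**Smoothness.** If `f` is odd and `f'(0) = 1` then `f = t h` and `1 - h² = t² k` with `h`, `k` even
and smooth, and in Cartesian coordinates the metric is `h(|x|)² ⟨·,·⟩ + k(|x|) x ⊗ x`. An even
smooth function of `|x|` is smooth, because its gradient is `(g'(t)/t) x` and `g'(t)/t` is again
even and smooth (`contDiffOn_comp_norm`).

**Curvature.** In terms of radial components `u_r`, `v_r` the Christoffel symbols are
`P (u_r v + v_r u - 2 u_r v_r ∂_t) + Q (⟨u,v⟩ - u_r v_r) ∂_t` with `P = f'/f - 1/t` and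
`Q = 1/t - f f'/t²` (`christoffel_warpedMetric`). It follows that the radial sectional curvatures
are `-f''/f` and the mean curvature of the spheres is `(n-1) f'/f`, so that `K ≤ κ` amounts to
`ψ_f' ≤ 0` and `H_f ≥ H_{S_κ}` to `ψ_f ≤ 0`.

**Distance.** The metric dominates `dt²`, hence `|x|` varies along a curve by at most its length
(`enorm_norm_sub_norm_le_curveLength`), and radial segments realize equality. A Cauchy sequence is
therefore bounded, and on bounded sets the metric is comparable to the Euclidean one; this gives
completeness.

**Examples.** With `T = ∫₀ᵗ S_κ²` and `m = T(t₀)²`, the function `ψ = -T / (m + T²)` is odd,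
nonpositive on the model interval, and strictly increasing there for `t > t₀`. Since `ψ'` is
divisible by `S_κ`, the right-hand side of `f'' + κ f = -ψ' / S_κ` is smooth on all of `ℝ`, and the
solution is given by variation of constants (`modelWarping`). For `κ > 0` its value at `π/√κ` is
`-ψ(π/√κ) > 0`, so it can be changed beyond that point to stay positive.
-/

noncomputable section

/-! ### Averages over segments and division by the variable -/

/-- A set of reals in which every point has a relative neighborhood `[a, b]` with `a ≤ 0 ≤ b`, and on
which derivatives are unique. These are the common properties of `[0, a)` and `(-a, a)` that allow
averaging over the segments from `0`. -/
structure IsStarDomain (J : Set ℝ) : Prop where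
  uniqueDiffOn : UniqueDiffOn ℝ J
  exists_Icc : ∀ t ∈ J, ∃ a b : ℝ, a ≤ 0 ∧ 0 ≤ b ∧ Icc a b ⊆ J ∧ Icc a b ∈ 𝓝[J] t

theorem mul_mem_Icc_of_mem {a b t s : ℝ} (ha : a ≤ 0) (hb : 0 ≤ b) (ht : t ∈ Icc a b)
    (hs : s ∈ Icc (0 : ℝ) 1) : t * s ∈ Icc a b := by
  obtain ⟨h1, h2⟩ := ht
  obtain ⟨h3, h4⟩ := hs
  constructor <;> nlinarith

theorem IsStarDomain.mul_mem {J : Set ℝ} (hJ : IsStarDomain J) {t s : ℝ} (ht : t ∈ J)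
    (hs : s ∈ Icc (0 : ℝ) 1) : t * s ∈ J := by
  obtain ⟨a, b, ha, hb, hK, hn⟩ := hJ.exists_Icc t ht
  exact hK (mul_mem_Icc_of_mem ha hb (mem_of_mem_nhdsWithin ht hn) hs)

/-- The average `∫₀¹ s^k w(ts) ds` of `w` over the segment from `0` to `t`, with the weight `s^k`; the
weights make the family closed under differentiation in `t`. -/
def radialAverage (k : ℕ) (w : ℝ → ℝ) (t : ℝ) : ℝ := ∫ s in (0 : ℝ)..1, s ^ k * w (t * s)

theorem intervalIntegrable_radialAverage {J : Set ℝ} (hJ : IsStarDomain J) {w : ℝ → ℝ}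
    (hw : ContinuousOn w J) (k : ℕ) {t : ℝ} (ht : t ∈ J) :
    IntervalIntegrable (fun s => s ^ k * w (t * s)) volume 0 1 := by
  apply ContinuousOn.intervalIntegrable
  rw [uIcc_of_le zero_le_one]
  refine (by fun_prop : ContinuousOn (fun s : ℝ => s ^ k) _).mul (hw.comp (by fun_prop) ?_)
  intro s hs
  exact hJ.mul_mem ht hs

/-- Differentiation under the integral sign, by dominated convergence of the difference quotients;
`t` may be an end point of `J`. -/
theorem hasDerivWithinAt_radialAverage {J : Set ℝ} (hJ : IsStarDomain J) {w : ℝ → ℝ}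
    (hw : ContDiffOn ℝ 1 w J) (k : ℕ) {t : ℝ} (ht : t ∈ J) :
    HasDerivWithinAt (radialAverage k w) (radialAverage (k + 1) (derivWithin w J) t) J t := by
  obtain ⟨a, b, ha, hb, hK, hn⟩ := hJ.exists_Icc t ht
  have htK : t ∈ Icc a b := mem_of_mem_nhdsWithin ht hn
  have hd : DifferentiableOn ℝ w J := hw.differentiableOn one_ne_zero
  have hc : ContinuousOn (derivWithin w J) J :=
    hw.continuousOn_derivWithin hJ.uniqueDiffOn le_rfl
  obtain ⟨C, hC⟩ := isCompact_Icc.exists_bound_of_continuousOn (hc.mono hK)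
  have hC0 : 0 ≤ C := (norm_nonneg _).trans (hC t htK)
  have hlip : ∀ y ∈ Icc a b, ∀ z ∈ Icc a b, ‖w z - w y‖ ≤ C * ‖z - y‖ := fun y hy z hz =>
    (convex_Icc a b).norm_image_sub_le_of_norm_hasDerivWithin_le
      (fun x hx => (hd x (hK hx)).hasDerivWithinAt.mono hK) hC hy hz
  rw [hasDerivWithinAt_iff_tendsto_slope]
  have hev : ∀ᶠ y in 𝓝[J \ {t}] t, y ∈ Icc a b ∧ y ∈ J ∧ y ≠ t := by
    have h1 : ∀ᶠ y in 𝓝[J \ {t}] t, y ∈ Icc a b := nhdsWithin_mono _ sdiff_subset hn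
    filter_upwards [h1, self_mem_nhdsWithin] with y hy hy'
    exact ⟨hy, hy'.1, hy'.2⟩
  have key : Tendsto (fun y => ∫ s in (0 : ℝ)..1, s ^ k * ((y - t)⁻¹ * (w (y * s) - w (t * s))))
      (𝓝[J \ {t}] t) (𝓝 (radialAverage (k + 1) (derivWithin w J) t)) := by
    refine intervalIntegral.tendsto_integral_filter_of_dominated_convergence (fun _ => C) ?_ ?_
      intervalIntegrable_const ?_
    · filter_upwards [hev] with y hy
      have h := ((intervalIntegrable_radialAverage hJ hw.continuousOn k hy.2.1).sub
        (intervalIntegrable_radialAverage hJ hw.continuousOn k ht)).const_mul (y - t)⁻¹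
      have h' := h.aestronglyMeasurable
      rw [uIoc_of_le zero_le_one]
      refine h'.congr (Eventually.of_forall fun s => ?_)
      simp only
      ring
    · filter_upwards [hev] with y hy
      refine Eventually.of_forall fun s hs => ?_
      rw [uIoc_of_le zero_le_one] at hs
      have hs' : s ∈ Icc (0 : ℝ) 1 := ⟨hs.1.le, hs.2⟩
      have h1 := hlip _ (mul_mem_Icc_of_mem ha hb htK hs') _ (mul_mem_Icc_of_mem ha hb hy.1 hs')
      have hyt : 0 < ‖y - t‖ := norm_pos_iff.2 (sub_ne_zero.2 hy.2.2)
      have h2 : ‖y * s - t * s‖ ≤ ‖y - t‖ := by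
        rw [← sub_mul, norm_mul, Real.norm_of_nonneg hs'.1]
        exact mul_le_of_le_one_right (norm_nonneg _) hs'.2
      rw [norm_mul, norm_mul, norm_inv, norm_pow, Real.norm_of_nonneg hs'.1]
      have h3 : ‖y - t‖⁻¹ * ‖w (y * s) - w (t * s)‖ ≤ C := by
        rw [inv_mul_le_iff₀ hyt, mul_comm _ C]
        exact h1.trans (mul_le_mul_of_nonneg_left h2 hC0)
      calc s ^ k * (‖y - t‖⁻¹ * ‖w (y * s) - w (t * s)‖) ≤ 1 * C :=
            mul_le_mul (pow_le_one₀ hs'.1 hs'.2) h3 (by positivity) zero_le_one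
        _ = C := one_mul C
    · refine Eventually.of_forall fun s hs => ?_
      rw [uIoc_of_le zero_le_one] at hs
      have hs' : s ∈ Icc (0 : ℝ) 1 := ⟨hs.1.le, hs.2⟩
      have hmaps : MapsTo (fun y => y * s) J J := fun y hy => hJ.mul_mem hy hs'
      have h1 : HasDerivWithinAt (fun y => w (y * s)) (derivWithin w J (t * s) * s) J t :=
        ((hd _ (hJ.mul_mem ht hs')).hasDerivWithinAt).comp t
          ((hasDerivAt_mul_const s).hasDerivWithinAt) hmaps
      have h2 := (hasDerivWithinAt_iff_tendsto_slope.1 h1).const_mul (s ^ k)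
      have h3 : s ^ (k + 1) * derivWithin w J (t * s) = s ^ k * (derivWithin w J (t * s) * s) := by
        ring
      rw [h3]
      exact h2
  refine key.congr' ?_
  filter_upwards [hev] with y hy
  rw [slope_def_field, radialAverage, radialAverage, ← intervalIntegral.integral_sub
    (intervalIntegrable_radialAverage hJ hw.continuousOn k hy.2.1)
    (intervalIntegrable_radialAverage hJ hw.continuousOn k ht), div_eq_inv_mul,
    ← intervalIntegral.integral_const_mul]
  congr 1
  ext s
  ring

theorem contDiffOn_radialAverage {J : Set ℝ} (hJ : IsStarDomain J) {w : ℝ → ℝ}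
    (hw : ContDiffOn ℝ ∞ w J) (k : ℕ) : ContDiffOn ℝ ∞ (radialAverage k w) J := by
  rw [contDiffOn_infty]
  intro m
  induction m generalizing w k with
  | zero =>
    exact contDiffOn_zero.2 fun t ht =>
      (hasDerivWithinAt_radialAverage hJ (hw.of_le (by simp)) k ht).continuousWithinAt
  | succ m ih =>
    have h := fun t ht => hasDerivWithinAt_radialAverage hJ (hw.of_le (by simp)) k (t := t) ht
    have hw' : ContDiffOn ℝ ∞ (derivWithin w J) J := hw.derivWithin hJ.uniqueDiffOn (by simp)
    rw [Nat.cast_add, Nat.cast_one, contDiffOn_succ_iff_derivWithin hJ.uniqueDiffOn]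
    refine ⟨fun t ht => (h t ht).differentiableWithinAt, by simp, ?_⟩
    exact (ih hw' (k + 1)).congr fun t ht => (h t ht).derivWithin (hJ.uniqueDiffOn t ht)

theorem radialAverage_even {w : ℝ → ℝ} (hw : ∀ t, w (-t) = w t) (k : ℕ) (t : ℝ) :
    radialAverage k w (-t) = radialAverage k w t := by
  simp [radialAverage, hw]

theorem radialAverage_odd {w : ℝ → ℝ} (hw : ∀ t, w (-t) = -w t) (k : ℕ) (t : ℝ) :
    radialAverage k w (-t) = -radialAverage k w t := by
  simp [radialAverage, hw]

@[simp] theorem radialAverage_zero_right (w : ℝ → ℝ) : radialAverage 0 w 0 = w 0 := by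
  simp [radialAverage]

theorem mul_radialAverage (w : ℝ → ℝ) (t : ℝ) :
    t * radialAverage 0 w t = ∫ s in (0 : ℝ)..t, w s := by
  have h := intervalIntegral.mul_integral_comp_mul_left (f := w) (a := 0) (b := 1) (c := t)
  simpa only [radialAverage, pow_zero, one_mul, mul_zero, mul_one] using h

/-- Hadamard's lemma: `w(t) - w(0)` is `t` times a smooth function. -/
theorem mul_radialAverage_derivWithin {J : Set ℝ} (hJ : IsStarDomain J) {w : ℝ → ℝ}
    (hw : ContDiffOn ℝ ∞ w J) {t : ℝ} (ht : t ∈ J) :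
    t * radialAverage 0 (derivWithin w J) t = w t - w 0 := by
  have hd : DifferentiableOn ℝ w J := hw.differentiableOn (by simp)
  have hc : ContinuousOn (derivWithin w J) J :=
    hw.continuousOn_derivWithin hJ.uniqueDiffOn (by simp)
  have h1 : ∀ s ∈ Icc (0 : ℝ) 1, HasDerivWithinAt (fun s => w (t * s))
      (derivWithin w J (t * s) * t) (Icc 0 1) s := fun s hs => by
    have := ((hd _ (hJ.mul_mem ht hs)).hasDerivWithinAt).comp s
      ((hasDerivAt_const_mul t).hasDerivWithinAt (s := Icc 0 1)) (fun y hy => hJ.mul_mem ht hy)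
    exact this
  have hint : IntervalIntegrable (fun s => derivWithin w J (t * s) * t) volume 0 1 := by
    have := intervalIntegrable_radialAverage hJ hc 0 ht
    simpa using this.mul_const t
  have h2 := intervalIntegral.integral_eq_sub_of_hasDerivAt_of_le zero_le_one
    (fun s hs => (h1 s hs).continuousWithinAt)
    (fun s hs => (h1 s ⟨hs.1.le, hs.2.le⟩).hasDerivAt (Icc_mem_nhds hs.1 hs.2)) hint
  simp only [mul_one, mul_zero] at h2
  rw [← h2, intervalIntegral.integral_mul_const, mul_comm]
  simp [radialAverage]

theorem derivWithin_even_of_odd {J : Set ℝ} (hJ : ∀ t, -t ∈ J ↔ t ∈ J) {w : ℝ → ℝ}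
    (hw : ∀ t, w (-t) = -w t) (t : ℝ) : derivWithin w J (-t) = derivWithin w J t := by
  have h := derivWithin_comp_neg w J (-t)
  have h1 : (fun x => w (-x)) = fun x => -w x := funext hw
  have h2 : -J = J := by ext x; simp [hJ]
  rw [h1, h2] at h
  simp only [neg_neg] at h
  rw [derivWithin.fun_neg] at h
  linarith

theorem derivWithin_odd_of_even {J : Set ℝ} (hJ : ∀ t, -t ∈ J ↔ t ∈ J) {w : ℝ → ℝ}
    (hw : ∀ t, w (-t) = w t) (t : ℝ) : derivWithin w J (-t) = -derivWithin w J t := by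
  have h := derivWithin_comp_neg w J (-t)
  have h1 : (fun x => w (-x)) = w := funext hw
  have h2 : -J = J := by ext x; simp [hJ]
  rw [h1, h2] at h
  simp only [neg_neg] at h
  exact h

/-! ### The model functions and the comparison function -/

theorem zero_mem_modelInterval (κ : ℝ) : (0 : ℝ) ∈ modelInterval κ :=
  ⟨le_rfl, fun _ => by simpa using Real.pi_pos⟩

theorem mem_modelInterval_of_le {κ s t : ℝ} (ht : t ∈ modelInterval κ) (hs : 0 ≤ s)
    (hst : s ≤ t) : s ∈ modelInterval κ :=
  ⟨hs, fun hκ => (mul_le_mul_of_nonneg_left hst (Real.sqrt_nonneg κ)).trans_lt (ht.2 hκ)⟩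

theorem mem_modelInterval_of_nonpos {κ t : ℝ} (hκ : κ ≤ 0) (ht : 0 ≤ t) : t ∈ modelInterval κ :=
  ⟨ht, fun h => absurd h hκ.not_gt⟩

theorem mem_modelInterval_iff_of_pos {κ : ℝ} (hκ : 0 < κ) {t : ℝ} :
    t ∈ modelInterval κ ↔ 0 ≤ t ∧ t < Real.pi / √κ := by
  have h : 0 < √κ := Real.sqrt_pos.2 hκ
  rw [lt_div_iff₀' h]
  exact ⟨fun ht => ⟨ht.1, ht.2 hκ⟩, fun ht => ⟨ht.1, fun _ => ht.2⟩⟩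

theorem exists_gt_mem_modelInterval {κ t : ℝ} (ht : t ∈ modelInterval κ) :
    ∃ b ∈ modelInterval κ, t < b := by
  rcases le_or_gt κ 0 with hκ | hκ
  · exact ⟨t + 1, mem_modelInterval_of_nonpos hκ (by linarith [ht.1]), by linarith⟩
  · rw [mem_modelInterval_iff_of_pos hκ] at ht
    obtain ⟨b, h1, h2⟩ := exists_between ht.2
    exact ⟨b, (mem_modelInterval_iff_of_pos hκ).2 ⟨by linarith [ht.1], h2⟩, h1⟩

theorem isStarDomain_modelInterval (κ : ℝ) : IsStarDomain (modelInterval κ) := by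
  constructor
  · apply uniqueDiffOn_convex
    · apply OrdConnected.convex
      exact ⟨fun x hx y hy z hz => mem_modelInterval_of_le hy (hx.1.trans hz.1) hz.2⟩
    · obtain ⟨b, hb, h0⟩ := exists_gt_mem_modelInterval (zero_mem_modelInterval κ)
      refine ⟨b / 2, mem_interior.2 ⟨Ioo 0 b, ?_, isOpen_Ioo, by constructor <;> linarith⟩⟩
      exact fun s hs => mem_modelInterval_of_le hb hs.1.le hs.2.le
  · intro t ht
    obtain ⟨b, hb, htb⟩ := exists_gt_mem_modelInterval ht
    refine ⟨0, b, le_rfl, hb.1, fun s hs => mem_modelInterval_of_le hb hs.1 hs.2, ?_⟩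
    filter_upwards [self_mem_nhdsWithin, mem_nhdsWithin_of_mem_nhds (Iio_mem_nhds htb)] with s h1 h2
    exact ⟨h1.1, h2.le⟩

theorem modelInterval_mem_nhds {κ t : ℝ} (ht : t ∈ modelInterval κ) (h0 : 0 < t) :
    modelInterval κ ∈ 𝓝 t := by
  obtain ⟨b, hb, htb⟩ := exists_gt_mem_modelInterval ht
  filter_upwards [Icc_mem_nhds h0 htb] with s hs
  exact mem_modelInterval_of_le hb hs.1 hs.2

/-- The symmetric interval `(-a_κ, a_κ)`. -/
def symmInterval (κ : ℝ) : Set ℝ := {t | |t| ∈ modelInterval κ}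

theorem neg_mem_symmInterval {κ : ℝ} (t : ℝ) : -t ∈ symmInterval κ ↔ t ∈ symmInterval κ := by
  simp [symmInterval]

theorem modelInterval_subset_symmInterval (κ : ℝ) : modelInterval κ ⊆ symmInterval κ :=
  fun t ht => by rwa [symmInterval, mem_ofPred_eq, abs_of_nonneg ht.1]

theorem isOpen_symmInterval (κ : ℝ) : IsOpen (symmInterval κ) := by
  rw [isOpen_iff_mem_nhds]
  intro t ht
  obtain ⟨b, hb, htb⟩ := exists_gt_mem_modelInterval ht
  filter_upwards [continuous_abs.continuousAt.eventually_lt_const htb] with s hs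
  exact mem_modelInterval_of_le hb (abs_nonneg s) hs.le

theorem isStarDomain_symmInterval (κ : ℝ) : IsStarDomain (symmInterval κ) := by
  refine ⟨(isOpen_symmInterval κ).uniqueDiffOn, fun t ht => ?_⟩
  obtain ⟨b, hb, htb⟩ := exists_gt_mem_modelInterval ht
  refine ⟨-b, b, by linarith [hb.1], hb.1, fun s hs =>
    mem_modelInterval_of_le hb (abs_nonneg s) (abs_le.2 hs), ?_⟩
  have h := abs_lt.1 htb
  exact mem_nhdsWithin_of_mem_nhds (Icc_mem_nhds h.1 h.2)

/-- The derivative of `S_κ`: hyperbolic cosine, `1` or cosine. -/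
def modelC (κ t : ℝ) : ℝ :=
  if κ < 0 then Real.cosh (√(-κ) * t) else if κ = 0 then 1 else Real.cos (√κ * t)

theorem hasDerivAt_modelS (κ t : ℝ) : HasDerivAt (modelS κ) (modelC κ t) t := by
  rcases lt_trichotomy κ 0 with h | h | h
  · have h1 : √(-κ) ≠ 0 := (Real.sqrt_pos.2 (by linarith)).ne'
    have := (((hasDerivAt_id t).const_mul √(-κ)).sinh).div_const √(-κ)
    simp only [id, mul_one, mul_div_cancel_right₀ _ h1] at this
    rw [show modelS κ = fun t => Real.sinh (√(-κ) * t) / √(-κ) by ext; simp [modelS, h],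
      modelC, if_pos h]
    exact this
  · subst h
    rw [show modelS 0 = id by ext; simp [modelS], show modelC 0 t = 1 by simp [modelC]]
    exact hasDerivAt_id t
  · have h1 : √κ ≠ 0 := (Real.sqrt_pos.2 h).ne'
    have := (((hasDerivAt_id t).const_mul √κ).sin).div_const √κ
    simp only [id, mul_one, mul_div_cancel_right₀ _ h1] at this
    rw [show modelS κ = fun t => Real.sin (√κ * t) / √κ by ext; simp [modelS, h.not_gt, h.ne'],
      modelC, if_neg h.not_gt, if_neg h.ne']
    exact this

theorem deriv_modelS (κ : ℝ) : deriv (modelS κ) = modelC κ :=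
  funext fun t => (hasDerivAt_modelS κ t).deriv

theorem hasDerivAt_modelC (κ t : ℝ) : HasDerivAt (modelC κ) (-κ * modelS κ t) t := by
  rcases lt_trichotomy κ 0 with h | h | h
  · have h1 : √(-κ) ≠ 0 := (Real.sqrt_pos.2 (by linarith)).ne'
    have h2 : √(-κ) ^ 2 = -κ := Real.sq_sqrt (by linarith)
    have := ((hasDerivAt_id t).const_mul √(-κ)).cosh
    rw [show modelC κ = fun t => Real.cosh (√(-κ) * t) by ext; simp [modelC, h],
      modelS, if_pos h]
    refine this.congr_deriv ?_
    rw [id, mul_one, mul_div_assoc', eq_div_iff h1, mul_assoc, ← pow_two, h2]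
    ring
  · subst h
    rw [show modelC 0 = fun _ => 1 by ext; simp [modelC]]
    simpa using hasDerivAt_const t (1 : ℝ)
  · have h1 : √κ ≠ 0 := (Real.sqrt_pos.2 h).ne'
    have h2 : √κ ^ 2 = κ := Real.sq_sqrt h.le
    have := ((hasDerivAt_id t).const_mul √κ).cos
    rw [show modelC κ = fun t => Real.cos (√κ * t) by ext; simp [modelC, h.not_gt, h.ne'],
      modelS, if_neg h.not_gt, if_neg h.ne']
    refine this.congr_deriv ?_
    rw [show -κ = -√κ ^ 2 by rw [h2]]
    simp only [id]
    field_simp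

theorem contDiff_modelS (κ : ℝ) : ContDiff ℝ ∞ (modelS κ) := by
  rcases lt_trichotomy κ 0 with h | h | h
  · rw [show modelS κ = fun t => Real.sinh (√(-κ) * t) / √(-κ) by ext; simp [modelS, h]]
    fun_prop
  · subst h
    rw [show modelS 0 = id by ext; simp [modelS]]
    fun_prop
  · rw [show modelS κ = fun t => Real.sin (√κ * t) / √κ by ext; simp [modelS, h.not_gt, h.ne']]
    fun_prop

theorem contDiff_modelC (κ : ℝ) : ContDiff ℝ ∞ (modelC κ) := by
  rw [← deriv_modelS]
  exact (contDiff_infty_iff_deriv.1 (contDiff_modelS κ)).2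

@[simp] theorem modelS_zero (κ : ℝ) : modelS κ 0 = 0 := by
  simp [modelS]

@[simp] theorem modelC_zero (κ : ℝ) : modelC κ 0 = 1 := by
  simp [modelC]

theorem modelS_neg (κ t : ℝ) : modelS κ (-t) = -modelS κ t := by
  simp only [modelS, mul_neg, Real.sinh_neg, Real.sin_neg, neg_div]
  split_ifs <;> rfl

theorem modelC_neg (κ t : ℝ) : modelC κ (-t) = modelC κ t := by
  simp only [modelC, mul_neg, Real.cosh_neg, Real.cos_neg]

theorem modelC_sq_add (κ t : ℝ) : modelC κ t ^ 2 + κ * modelS κ t ^ 2 = 1 := by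
  rcases lt_trichotomy κ 0 with h | h | h
  · have h1 : √(-κ) ≠ 0 := (Real.sqrt_pos.2 (by linarith)).ne'
    have h2 : √(-κ) ^ 2 = -κ := Real.sq_sqrt (by linarith)
    simp only [modelC, modelS, if_pos h, div_pow, h2]
    rw [Real.cosh_sq, mul_div_assoc', div_neg, mul_div_cancel_left₀ _ h.ne]
    ring
  · subst h
    simp [modelC]
  · have h2 : √κ ^ 2 = κ := Real.sq_sqrt h.le
    simp only [modelC, modelS, if_neg h.not_gt, if_neg h.ne', div_pow, h2]
    field_simp
    linarith [Real.cos_sq_add_sin_sq (√κ * t)]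

theorem modelS_pos {κ t : ℝ} (ht : t ∈ modelInterval κ) (h0 : 0 < t) : 0 < modelS κ t := by
  rcases lt_trichotomy κ 0 with h | h | h
  · have h1 : 0 < √(-κ) := Real.sqrt_pos.2 (by linarith)
    rw [modelS, if_pos h]
    exact div_pos (Real.sinh_pos_iff.2 (mul_pos h1 h0)) h1
  · simp [modelS, h, h0]
  · have h1 : 0 < √κ := Real.sqrt_pos.2 h
    rw [modelS, if_neg h.not_gt, if_neg h.ne']
    exact div_pos (Real.sin_pos_of_pos_of_lt_pi (mul_pos h1 h0) (ht.2 h)) h1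

theorem modelS_ne_zero {κ t : ℝ} (ht : t ∈ symmInterval κ) (h0 : t ≠ 0) : modelS κ t ≠ 0 := by
  rcases lt_or_gt_of_ne h0 with h | h
  · have h1 : -t ∈ modelInterval κ := by
      rw [symmInterval, mem_ofPred_eq, abs_of_neg h] at ht
      exact ht
    have := modelS_pos h1 (by linarith)
    rw [modelS_neg] at this
    linarith
  · have h1 : t ∈ modelInterval κ := by
      rw [symmInterval, mem_ofPred_eq, abs_of_pos h] at ht
      exact ht
    exact (modelS_pos h1 h).ne'

theorem mul_radialAverage_modelC (κ t : ℝ) : t * radialAverage 0 (modelC κ) t = modelS κ t := by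
  rw [mul_radialAverage, intervalIntegral.integral_eq_sub_of_hasDerivAt
    (fun s _ => hasDerivAt_modelS κ s) ((contDiff_modelC κ).continuous.intervalIntegrable _ _)]
  simp

/-- The smooth function `S_κ(t) / t` has no zeros, also at `t = 0`. -/
theorem radialAverage_modelC_ne_zero {κ t : ℝ} (ht : t ∈ symmInterval κ) :
    radialAverage 0 (modelC κ) t ≠ 0 := by
  rcases eq_or_ne t 0 with rfl | h0
  · simp
  · intro h
    have := mul_radialAverage_modelC κ t
    rw [h, mul_zero] at this
    exact modelS_ne_zero ht h0 this.symm

/-- Hadamard's lemma applied twice; the quotient of an even function is even. -/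
theorem exists_smooth_sq_mul {J : Set ℝ} (hJ : IsStarDomain J) {w : ℝ → ℝ}
    (hw : ContDiffOn ℝ ∞ w J) (h0 : w 0 = 0) (h1 : derivWithin w J 0 = 0) :
    ∃ h : ℝ → ℝ, ContDiffOn ℝ ∞ h J ∧ (∀ t ∈ J, w t = t ^ 2 * h t) ∧
      ((∀ t, -t ∈ J ↔ t ∈ J) → (∀ t, w (-t) = w t) → ∀ t, h (-t) = h t) := by
  have hw' : ContDiffOn ℝ ∞ (derivWithin w J) J := hw.derivWithin hJ.uniqueDiffOn (by simp)
  have hA := contDiffOn_radialAverage hJ hw' 0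
  have hA' : ContDiffOn ℝ ∞ (derivWithin (radialAverage 0 (derivWithin w J)) J) J :=
    hA.derivWithin hJ.uniqueDiffOn (by simp)
  refine ⟨_, contDiffOn_radialAverage hJ hA' 0, fun t ht => ?_, fun hs he => radialAverage_even
    (derivWithin_even_of_odd hs (radialAverage_odd (derivWithin_odd_of_even hs he) 0)) 0⟩
  have e1 := mul_radialAverage_derivWithin hJ hw ht
  have e2 := mul_radialAverage_derivWithin hJ hA ht
  rw [radialAverage_zero_right, h1, sub_zero] at e2
  rw [pow_two, mul_assoc, e2, e1, h0, sub_zero]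

/-- A function vanishing to second order at the origin may be divided by `S_κ²`. -/
theorem exists_smooth_div_modelS_sq {κ : ℝ} {J : Set ℝ} (hJ : IsStarDomain J)
    (hJκ : J ⊆ symmInterval κ) {w : ℝ → ℝ}
    (hw : ContDiffOn ℝ ∞ w J) (h0 : w 0 = 0) (h1 : derivWithin w J 0 = 0) :
    ∃ ρ : ℝ → ℝ, ContDiffOn ℝ ∞ ρ J ∧ ∀ t ∈ J, t ≠ 0 → w t / modelS κ t ^ 2 = ρ t := by
  obtain ⟨h, hh, hw2, -⟩ := exists_smooth_sq_mul hJ hw h0 h1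
  have hσ : ContDiffOn ℝ ∞ (radialAverage 0 (modelC κ)) J :=
    contDiffOn_radialAverage hJ (contDiff_modelC κ).contDiffOn 0
  refine ⟨fun t => h t / radialAverage 0 (modelC κ) t ^ 2, hh.div (hσ.pow 2) fun t ht =>
    pow_ne_zero 2 (radialAverage_modelC_ne_zero (hJκ ht)), fun t ht ht0 => ?_⟩
  rw [hw2 t ht, ← mul_radialAverage_modelC κ t, mul_pow, mul_div_mul_left _ _ (pow_ne_zero 2 ht0)]

/-- The value at the origin, where quotients take a junk value, does not affect the integral. -/
theorem integral_eq_of_eqOn_ne_zero {J : Set ℝ} (hJ : IsStarDomain J) {w ρ : ℝ → ℝ}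
    (hρ : ContinuousOn ρ J) (h : ∀ t ∈ J, t ≠ 0 → w t = ρ t) {t : ℝ} (ht : t ∈ J) :
    IntervalIntegrable w volume 0 t ∧ ∫ s in (0 : ℝ)..t, w s = ∫ s in (0 : ℝ)..t, ρ s := by
  have hsub : uIcc 0 t ⊆ J := by
    intro s hs
    obtain ⟨a, b, ha, hb, hK, hn⟩ := hJ.exists_Icc t ht
    have htK : t ∈ Icc a b := mem_of_mem_nhdsWithin ht hn
    exact hK (uIcc_subset_Icc ⟨ha, hb⟩ htK hs)
  have hae : ∀ᵐ s ∂volume, s ≠ (0 : ℝ) := compl_mem_ae_iff.2 (measure_singleton 0)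
  constructor
  · have hi : IntervalIntegrable ρ volume 0 t := (hρ.mono hsub).intervalIntegrable
    refine hi.congr_ae ?_
    rw [EventuallyEq, ae_restrict_iff' measurableSet_uIoc]
    filter_upwards [hae] with s hs hs'
    exact (h s (hsub (uIoc_subset_uIcc hs')) hs).symm
  · apply intervalIntegral.integral_congr_ae
    filter_upwards [hae] with s hs hs'
    exact h s (hsub (uIoc_subset_uIcc hs')) hs

theorem contDiffOn_integral {J : Set ℝ} (hJ : IsStarDomain J) {ρ : ℝ → ℝ}
    (hρ : ContDiffOn ℝ ∞ ρ J) : ContDiffOn ℝ ∞ (fun t => ∫ s in (0 : ℝ)..t, ρ s) J := by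
  simp only [← mul_radialAverage]
  exact contDiffOn_id.mul (contDiffOn_radialAverage hJ hρ 0)

theorem contDiffOn_integral_div_modelS_sq {κ : ℝ} {J : Set ℝ} (hJ : IsStarDomain J)
    (hJκ : J ⊆ symmInterval κ) {w : ℝ → ℝ}
    (hw : ContDiffOn ℝ ∞ w J) (h0 : w 0 = 0) (h1 : derivWithin w J 0 = 0) :
    ContDiffOn ℝ ∞ (fun t => ∫ s in (0 : ℝ)..t, w s / modelS κ s ^ 2) J := by
  obtain ⟨ρ, hρ, hwρ⟩ := exists_smooth_div_modelS_sq hJ hJκ hw h0 h1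
  exact (contDiffOn_integral hJ hρ).congr fun t ht =>
    (integral_eq_of_eqOn_ne_zero hJ hρ.continuousOn hwρ ht).2

theorem intervalIntegrable_div_modelS_sq {κ : ℝ} {J : Set ℝ} (hJ : IsStarDomain J)
    (hJκ : J ⊆ symmInterval κ) {w : ℝ → ℝ}
    (hw : ContDiffOn ℝ ∞ w J) (h0 : w 0 = 0) (h1 : derivWithin w J 0 = 0) {t : ℝ} (ht : t ∈ J) :
    IntervalIntegrable (fun s => w s / modelS κ s ^ 2) volume 0 t := by
  obtain ⟨ρ, hρ, hwρ⟩ := exists_smooth_div_modelS_sq hJ hJκ hw h0 h1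
  exact (integral_eq_of_eqOn_ne_zero hJ hρ.continuousOn hwρ ht).1

theorem contDiffOn_warpingOf {κ : ℝ} {J : Set ℝ} (hJ : IsStarDomain J)
    (hJκ : J ⊆ symmInterval κ) {w : ℝ → ℝ}
    (hw : ContDiffOn ℝ ∞ w J) (h0 : w 0 = 0) (h1 : derivWithin w J 0 = 0) :
    ContDiffOn ℝ ∞ (warpingOf κ w) J :=
  (contDiff_modelS κ).contDiffOn.sub ((contDiff_modelS κ).contDiffOn.mul
    (contDiffOn_integral_div_modelS_sq hJ hJκ hw h0 h1))

theorem warpingOf_neg {κ : ℝ} {w : ℝ → ℝ} (hw : ∀ t, w (-t) = -w t) (t : ℝ) :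
    warpingOf κ w (-t) = -warpingOf κ w t := by
  have h := intervalIntegral.integral_comp_neg (a := 0) (b := -t)
    (fun s => w s / modelS κ s ^ 2)
  simp only [neg_neg, neg_zero, hw, modelS_neg, neg_sq, neg_div] at h
  rw [intervalIntegral.integral_symm 0 t, intervalIntegral.integral_neg] at h
  simp only [warpingOf, modelS_neg]
  rw [show ∫ s in (0 : ℝ)..-t, w s / modelS κ s ^ 2 = ∫ s in (0 : ℝ)..t, w s / modelS κ s ^ 2 by
    linarith]
  ring

theorem hasDerivAt_warpingOf {κ : ℝ} {w : ℝ → ℝ} (hw : ContDiffOn ℝ ∞ w (modelInterval κ))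
    (h0 : w 0 = 0) (h1 : derivWithin w (modelInterval κ) 0 = 0) {t : ℝ}
    (ht : t ∈ modelInterval κ) (ht0 : 0 < t) :
    HasDerivAt (warpingOf κ w) (modelC κ t - (modelC κ t * (∫ s in (0 : ℝ)..t, w s / modelS κ s ^ 2)
      + modelS κ t * (w t / modelS κ t ^ 2))) t := by
  have hint := intervalIntegrable_div_modelS_sq (isStarDomain_modelInterval κ)
    (modelInterval_subset_symmInterval κ) hw h0 h1 ht
  have hcont : ContinuousOn (fun s => w s / modelS κ s ^ 2) (modelInterval κ ∩ Ioi 0) :=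
    (hw.continuousOn.mono inter_subset_left).div ((contDiff_modelS κ).continuous.pow 2).continuousOn
      fun s hs => pow_ne_zero 2 (modelS_pos hs.1 hs.2).ne'
  have hI : modelInterval κ ∩ Ioi 0 ∈ 𝓝 t :=
    inter_mem (modelInterval_mem_nhds ht ht0) (Ioi_mem_nhds ht0)
  have hmeas : StronglyMeasurableAtFilter (fun s => w s / modelS κ s ^ 2) (𝓝 t) volume := by
    obtain ⟨U, hU, hUo, htU⟩ := mem_nhds_iff.1 hI
    exact (hcont.mono hU).stronglyMeasurableAtFilter hUo t htU
  have hder := intervalIntegral.integral_hasDerivAt_right hint hmeas (hcont.continuousAt hI)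
  exact (hasDerivAt_modelS κ t).sub ((hasDerivAt_modelS κ t).mul hder)

theorem derivWithin_warpingOf_zero {κ : ℝ} {w : ℝ → ℝ} (hw : ContDiffOn ℝ ∞ w (modelInterval κ))
    (h0 : w 0 = 0) (h1 : derivWithin w (modelInterval κ) 0 = 0) :
    derivWithin (warpingOf κ w) (modelInterval κ) 0 = 1 := by
  have hJ := isStarDomain_modelInterval κ
  have hz := zero_mem_modelInterval κ
  have hd := ((contDiffOn_integral_div_modelS_sq hJ
    (modelInterval_subset_symmInterval κ) hw h0 h1).differentiableOn (by simp) 0 hz).hasDerivWithinAt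
  have hS := (hasDerivAt_modelS κ 0).hasDerivWithinAt (s := modelInterval κ)
  have := (hS.sub (hS.mul hd)).derivWithin (hJ.uniqueDiffOn 0 hz)
  simp only [modelC_zero, modelS_zero, intervalIntegral.integral_same, mul_zero, zero_mul, add_zero,
    sub_zero] at this
  exact this

theorem comparisonFn_warpingOf {κ : ℝ} {w : ℝ → ℝ} (hw : ContDiffOn ℝ ∞ w (modelInterval κ))
    (h0 : w 0 = 0) (h1 : derivWithin w (modelInterval κ) 0 = 0) :
    EqOn (comparisonFn κ (warpingOf κ w)) w (modelInterval κ) := by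
  intro t ht
  rcases ht.1.eq_or_lt with rfl | ht0
  · simp [comparisonFn, warpingOf, h0]
  · have hS := (modelS_pos ht ht0).ne'
    rw [comparisonFn, (hasDerivAt_warpingOf hw h0 h1 ht ht0).hasDerivWithinAt.derivWithin
      ((isStarDomain_modelInterval κ).uniqueDiffOn t ht), deriv_modelS, warpingOf]
    field_simp
    ring

theorem modelS_le_warpingOf {κ : ℝ} {w : ℝ → ℝ} (hw : ∀ t ∈ modelInterval κ, w t ≤ 0) {t : ℝ}
    (ht : t ∈ modelInterval κ) : modelS κ t ≤ warpingOf κ w t := by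
  have hS : 0 ≤ modelS κ t := by
    rcases ht.1.eq_or_lt with rfl | h
    · simp
    · exact (modelS_pos ht h).le
  have hi : ∫ s in (0 : ℝ)..t, w s / modelS κ s ^ 2 ≤ 0 := by
    rw [intervalIntegral.integral_of_le ht.1]
    exact setIntegral_nonpos measurableSet_Ioc fun s hs =>
      div_nonpos_of_nonpos_of_nonneg (hw s (mem_modelInterval_of_le ht hs.1.le hs.2)) (sq_nonneg _)
  have := mul_nonpos_of_nonneg_of_nonpos hS hi
  rw [warpingOf]
  linarith

theorem isWarping_warpingOf {κ : ℝ} {w : ℝ → ℝ} (hw : ContDiffOn ℝ ∞ w (modelInterval κ))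
    (h0 : w 0 = 0) (h1 : derivWithin w (modelInterval κ) 0 = 0)
    (hneg : ∀ t ∈ modelInterval κ, w t ≤ 0) : IsWarping κ (warpingOf κ w) where
  smooth := contDiffOn_warpingOf (isStarDomain_modelInterval κ)
    (modelInterval_subset_symmInterval κ) hw h0 h1
  zero := by simp [warpingOf]
  deriv_zero := derivWithin_warpingOf_zero hw h0 h1
  pos t ht ht0 := (modelS_pos ht ht0).trans_le (modelS_le_warpingOf hneg ht)

/-- At `t = 0` this compares a two-sided with a one-sided derivative. -/
theorem derivWithin_symmInterval {κ : ℝ} {H w : ℝ → ℝ} (hH : ContDiffOn ℝ ∞ H (symmInterval κ))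
    (h : EqOn H w (modelInterval κ)) {t : ℝ} (ht : t ∈ modelInterval κ) :
    derivWithin H (symmInterval κ) t = derivWithin w (modelInterval κ) t := by
  have h1 := ((hH.differentiableOn (by simp) t
    (modelInterval_subset_symmInterval κ ht)).hasDerivWithinAt.mono
    (modelInterval_subset_symmInterval κ)).congr_of_mem (fun x hx => (h hx).symm) ht
  exact (h1.derivWithin ((isStarDomain_modelInterval κ).uniqueDiffOn t ht)).symm

theorem hasSmoothOddExtension_warpingOf {κ : ℝ} {w : ℝ → ℝ} (h : HasSmoothOddExtension κ w)
    (h0 : w 0 = 0) (h1 : derivWithin w (modelInterval κ) 0 = 0) :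
    HasSmoothOddExtension κ (warpingOf κ w) := by
  obtain ⟨H, hH, hodd, heq⟩ := h
  have hz := zero_mem_modelInterval κ
  refine ⟨warpingOf κ H, contDiffOn_warpingOf (isStarDomain_symmInterval κ) subset_rfl hH
    ((heq hz).trans h0) ((derivWithin_symmInterval hH heq hz).trans h1), warpingOf_neg hodd, ?_⟩
  intro t ht
  simp only [warpingOf]
  congr 2
  apply intervalIntegral.integral_congr
  intro s hs
  rw [uIcc_of_le ht.1] at hs
  simp only [heq (mem_modelInterval_of_le ht hs.1 hs.2)]

theorem hasDerivWithinAt_comparisonFn {κ : ℝ} {f : ℝ → ℝ} (hf : ContDiffOn ℝ ∞ f (modelInterval κ))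
    {t : ℝ} (ht : t ∈ modelInterval κ) :
    HasDerivWithinAt (comparisonFn κ f)
      (-modelS κ t * (derivWithin (derivWithin f (modelInterval κ)) (modelInterval κ) t + κ * f t))
      (modelInterval κ) t := by
  have hu := (isStarDomain_modelInterval κ).uniqueDiffOn
  have h1 := (hf.differentiableOn (by simp) t ht).hasDerivWithinAt
  have h2 := (((hf.derivWithin hu (m := ∞) (by simp)).differentiableOn (by simp)) t
    ht).hasDerivWithinAt
  have hS := (hasDerivAt_modelS κ t).hasDerivWithinAt (s := modelInterval κ)
  have hC := (hasDerivAt_modelC κ t).hasDerivWithinAt (s := modelInterval κ)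
  have := (h2.neg.mul hS).add (h1.mul hC)
  rw [show comparisonFn κ f = fun t => -derivWithin f (modelInterval κ) t * modelS κ t
    + f t * modelC κ t by ext; rw [comparisonFn, deriv_modelS]]
  refine this.congr_deriv ?_
  simp only [Pi.neg_apply]
  ring

theorem derivWithin_comparisonFn {κ : ℝ} {f : ℝ → ℝ} (hf : ContDiffOn ℝ ∞ f (modelInterval κ))
    {t : ℝ} (ht : t ∈ modelInterval κ) :
    derivWithin (comparisonFn κ f) (modelInterval κ) t =
      -modelS κ t *
        (derivWithin (derivWithin f (modelInterval κ)) (modelInterval κ) t + κ * f t) :=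
  (hasDerivWithinAt_comparisonFn hf ht).derivWithin
    ((isStarDomain_modelInterval κ).uniqueDiffOn t ht)

theorem contDiffOn_comparisonFn {κ : ℝ} {f : ℝ → ℝ} (hf : ContDiffOn ℝ ∞ f (modelInterval κ)) :
    ContDiffOn ℝ ∞ (comparisonFn κ f) (modelInterval κ) := by
  have hu := (isStarDomain_modelInterval κ).uniqueDiffOn
  rw [show comparisonFn κ f = fun t => -derivWithin f (modelInterval κ) t * modelS κ t
    + f t * modelC κ t by ext; rw [comparisonFn, deriv_modelS]]
  exact ((hf.derivWithin hu (m := ∞) (by simp)).neg.mul (contDiff_modelS κ).contDiffOn).add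
    (hf.mul (contDiff_modelC κ).contDiffOn)

theorem comparisonFn_zero {κ : ℝ} {f : ℝ → ℝ} (h0 : f 0 = 0) : comparisonFn κ f 0 = 0 := by
  simp [comparisonFn, h0]

theorem derivWithin_comparisonFn_zero {κ : ℝ} {f : ℝ → ℝ}
    (hf : ContDiffOn ℝ ∞ f (modelInterval κ)) :
    derivWithin (comparisonFn κ f) (modelInterval κ) 0 = 0 := by
  simp [derivWithin_comparisonFn hf (zero_mem_modelInterval κ)]

/-- `f / S_κ` has the derivative `-ψ_f / S_κ²` and the limit `1` at the origin. -/
theorem eqOn_warpingOf_comparisonFn {κ : ℝ} {f : ℝ → ℝ} (hf : ContDiffOn ℝ ∞ f (modelInterval κ))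
    (h0 : f 0 = 0) (h1 : derivWithin f (modelInterval κ) 0 = 1) :
    EqOn f (warpingOf κ (comparisonFn κ f)) (modelInterval κ) := by
  intro t ht
  rcases ht.1.eq_or_lt with rfl | ht0
  · simp [warpingOf, h0]
  have hJ := isStarDomain_modelInterval κ
  have hu := hJ.uniqueDiffOn
  have hS := (modelS_pos ht ht0).ne'
  -- `f / S_κ` extended by its limit `1` at the origin
  set u : ℝ → ℝ := fun t => radialAverage 0 (derivWithin f (modelInterval κ)) t /
    radialAverage 0 (modelC κ) t with hu_def
  have hu_eq : ∀ s ∈ modelInterval κ, 0 < s → u s = f s / modelS κ s := by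
    intro s hs hs0
    rw [hu_def, ← mul_radialAverage_modelC κ s, ← sub_zero (f s), ← h0,
      ← mul_radialAverage_derivWithin hJ hf hs, mul_div_mul_left _ _ hs0.ne']
  have huc : ContinuousOn u (modelInterval κ) :=
    (contDiffOn_radialAverage hJ (hf.derivWithin hu (m := ∞) (by simp)) 0).continuousOn.div
      (contDiffOn_radialAverage hJ (contDiff_modelC κ).contDiffOn 0).continuousOn
      fun s hs => radialAverage_modelC_ne_zero (modelInterval_subset_symmInterval κ hs)
  have hder : ∀ s ∈ Ioo 0 t, HasDerivAt u (-(comparisonFn κ f s / modelS κ s ^ 2)) s := by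
    intro s hs
    have hsI := mem_modelInterval_of_le ht hs.1.le hs.2.le
    have hn := modelInterval_mem_nhds hsI hs.1
    have hSs := (modelS_pos hsI hs.1).ne'
    have h2 := ((hf.differentiableOn (by simp) s hsI).hasDerivWithinAt.hasDerivAt hn).div
      (hasDerivAt_modelS κ s) hSs
    refine (h2.congr_of_eventuallyEq ?_).congr_deriv ?_
    · filter_upwards [hn, Ioi_mem_nhds hs.1] with y hy hy0
      exact hu_eq y hy hy0
    · rw [comparisonFn, deriv_modelS]
      field_simp
      ring
  have hint := intervalIntegrable_div_modelS_sq hJ (modelInterval_subset_symmInterval κ)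
    (contDiffOn_comparisonFn hf) (comparisonFn_zero h0) (derivWithin_comparisonFn_zero hf) ht
  have hF := intervalIntegral.integral_eq_sub_of_hasDerivAt_of_le ht.1
    (huc.mono fun s hs => mem_modelInterval_of_le ht hs.1 hs.2) hder hint.neg
  have hu0 : u 0 = 1 := by simp [hu_def, h1]
  rw [intervalIntegral.integral_neg, hu0, hu_eq t ht ht0] at hF
  rw [warpingOf]
  have : f t = modelS κ t * (f t / modelS κ t) := by field_simp
  rw [this, show f t / modelS κ t = 1 - ∫ s in (0 : ℝ)..t, comparisonFn κ f s / modelS κ s ^ 2 by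
    linarith]
  ring

theorem isWarping_modelS (κ : ℝ) : IsWarping κ (modelS κ) where
  smooth := (contDiff_modelS κ).contDiffOn
  zero := modelS_zero κ
  deriv_zero := by
    rw [(hasDerivAt_modelS κ 0).hasDerivWithinAt.derivWithin
      ((isStarDomain_modelInterval κ).uniqueDiffOn 0 (zero_mem_modelInterval κ)), modelC_zero]
  pos _ ht h0 := modelS_pos ht h0

theorem hasSmoothOddExtension_of_contDiff {κ : ℝ} {f : ℝ → ℝ} (hf : ContDiff ℝ ∞ f)
    (hodd : ∀ t, f (-t) = -f t) : HasSmoothOddExtension κ f :=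
  ⟨f, hf.contDiffOn, hodd, fun _ _ => rfl⟩

/-! ### Smoothness of rotationally symmetric metrics -/

variable {n : ℕ}

theorem contDiffOn_smul_const_add_smul {E F : Type*} [NormedAddCommGroup E] [NormedSpace ℝ E]
    [NormedAddCommGroup F] [NormedSpace ℝ F] {s : Set E} {a b : E → ℝ} {A : F} {B : E → F}
    (ha : ContDiffOn ℝ ∞ a s) (hb : ContDiffOn ℝ ∞ b s) (hB : ContDiffOn ℝ ∞ B s) :
    ContDiffOn ℝ ∞ (fun x => a x • A + b x • B x) s :=
  (ha.smul contDiffOn_const).add (hb.smul hB)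

theorem tendsto_smul_const_add_smul {E F : Type*} [NormedAddCommGroup F] [NormedSpace ℝ F]
    {l : Filter E} {a : E → ℝ} {A : F} {B : E → F}
    (ha : Tendsto a l (𝓝 1)) (hB : ∀ x, ‖B x‖ ≤ 1) :
    Tendsto (fun x => a x • A + (1 - a x) • B x) l (𝓝 A) := by
  have h1 : Tendsto (fun x => a x • A) l (𝓝 A) := by simpa using ha.smul_const A
  have h3 : Tendsto (fun x => |1 - a x|) l (𝓝 0) := by simpa using (ha.const_sub 1).abs
  have h2 : Tendsto (fun x => (1 - a x) • B x) l (𝓝 0) := by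
    refine squeeze_zero_norm (fun y => ?_) h3
    rw [norm_smul, Real.norm_eq_abs]
    exact mul_le_of_le_one_right (abs_nonneg _) (hB y)
  simpa using h1.add h2

theorem hasDerivAt_derivWithin_symmInterval {κ : ℝ} {g : ℝ → ℝ}
    (hg : ContDiffOn ℝ ∞ g (symmInterval κ)) {t : ℝ} (ht : t ∈ symmInterval κ) :
    HasDerivAt g (derivWithin g (symmInterval κ) t) t :=
  (hg.differentiableOn (by simp) t ht).hasDerivWithinAt.hasDerivAt
    ((isOpen_symmInterval κ).mem_nhds ht)

theorem norm_mem_symmInterval {κ : ℝ} {x : Euc n} (hx : x ∈ modelBall n κ) :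
    ‖x‖ ∈ symmInterval κ :=
  modelInterval_subset_symmInterval κ hx

theorem isOpen_modelBall (n : ℕ) (κ : ℝ) : IsOpen (modelBall n κ) := by
  have h : modelBall n κ = (fun x : Euc n => ‖x‖) ⁻¹' symmInterval κ := by
    ext x
    simp [modelBall, symmInterval]
  rw [h]
  exact (isOpen_symmInterval κ).preimage continuous_norm

theorem hasFDerivAt_norm_of_ne_zero {x : Euc n} (hx : x ≠ 0) :
    HasFDerivAt (fun y : Euc n => ‖y‖) (‖x‖⁻¹ • euclForm n x) x := by
  have h1 : HasFDerivAt (fun y : Euc n => ‖y‖ ^ 2) ((2 : ℝ) • euclForm n x) x := by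
    refine (hasStrictFDerivAt_norm_sq x).hasFDerivAt.congr_fderiv ?_
    ext v
    simp [euclForm_apply]
  have hx' : ‖x‖ ≠ 0 := norm_ne_zero_iff.2 hx
  have h2 := h1.sqrt (pow_ne_zero 2 hx')
  simp only [Real.sqrt_sq (norm_nonneg _)] at h2
  refine h2.congr_fderiv ?_
  rw [smul_smul]
  congr 1
  field_simp

/-- The gradient of `g(|x|)` is `(g'(t)/t) x`; evenness of `g` makes this correct at the origin. -/
theorem hasFDerivAt_comp_norm {κ : ℝ} {g : ℝ → ℝ} (hg : ContDiffOn ℝ ∞ g (symmInterval κ))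
    (heven : ∀ t, g (-t) = g t) {x : Euc n} (hx : x ∈ modelBall n κ) :
    HasFDerivAt (fun y : Euc n => g ‖y‖)
      (radialAverage 0 (derivWithin (derivWithin g (symmInterval κ)) (symmInterval κ)) ‖x‖ •
        euclForm n x) x := by
  have hJ := isStarDomain_symmInterval κ
  have hg' := hg.derivWithin hJ.uniqueDiffOn (m := ∞) (by simp)
  have hodd := derivWithin_odd_of_even neg_mem_symmInterval heven (J := symmInterval κ)
  have h0 : derivWithin g (symmInterval κ) 0 = 0 := by
    have := hodd 0
    rw [neg_zero] at this
    linarith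
  have hk := mul_radialAverage_derivWithin hJ hg' (norm_mem_symmInterval hx)
  rw [h0, sub_zero] at hk
  rcases eq_or_ne x 0 with rfl | hx0
  · have hd := hasDerivAt_derivWithin_symmInterval hg (norm_mem_symmInterval hx)
    rw [norm_zero, h0] at hd
    rw [map_zero, smul_zero, hasFDerivAt_iff_isLittleO_nhds_zero]
    have h2 := (hasDerivAt_iff_isLittleO_nhds_zero.1 hd).comp_tendsto
      (tendsto_norm_zero : Tendsto (fun y : Euc n => ‖y‖) (𝓝 0) (𝓝 0))
    simp only [Function.comp_def, zero_add, smul_zero, sub_zero] at h2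
    simpa using h2.of_norm_right
  · have h1 := (hasDerivAt_derivWithin_symmInterval hg
      (norm_mem_symmInterval hx)).comp_hasFDerivAt x (hasFDerivAt_norm_of_ne_zero hx0)
    refine h1.congr_fderiv ?_
    rw [← hk, smul_smul]
    congr 1
    have : ‖x‖ ≠ 0 := norm_ne_zero_iff.2 hx0
    field_simp

/-- An even smooth function of the radius is a smooth function on the ball. -/
theorem contDiffOn_comp_norm {κ : ℝ} {g : ℝ → ℝ} (hg : ContDiffOn ℝ ∞ g (symmInterval κ))
    (heven : ∀ t, g (-t) = g t) : ContDiffOn ℝ ∞ (fun x : Euc n => g ‖x‖) (modelBall n κ) := by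
  rw [contDiffOn_infty]
  intro m
  induction m generalizing g with
  | zero =>
    exact contDiffOn_zero.2 fun x hx =>
      (hasFDerivAt_comp_norm hg heven hx).continuousAt.continuousWithinAt
  | succ m ih =>
    have hJ := isStarDomain_symmInterval κ
    have hg' := hg.derivWithin hJ.uniqueDiffOn (m := ∞) (by simp)
    have hg'' := hg'.derivWithin hJ.uniqueDiffOn (m := ∞) (by simp)
    have hk := ih (contDiffOn_radialAverage hJ hg'' 0) (radialAverage_even
      (derivWithin_even_of_odd neg_mem_symmInterval
        (derivWithin_odd_of_even neg_mem_symmInterval heven)) 0)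
    rw [Nat.cast_add, Nat.cast_one, contDiffOn_succ_iff_fderiv_of_isOpen (isOpen_modelBall n κ)]
    refine ⟨fun x hx =>
      (hasFDerivAt_comp_norm hg heven hx).differentiableAt.differentiableWithinAt, by simp, ?_⟩
    refine (hk.smul (euclForm n).contDiff.contDiffOn).congr fun x hx => ?_
    exact (hasFDerivAt_comp_norm hg heven hx).fderiv

theorem norm_radialField {x : Euc n} (hx : x ≠ 0) : ‖radialField x‖ = 1 := by
  rw [radialField, norm_smul, norm_inv, norm_norm, inv_mul_cancel₀ (norm_ne_zero_iff.mpr hx)]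

theorem warpedMetric_apply (f : ℝ → ℝ) {x : Euc n} (hx : x ≠ 0) (v w : Euc n) :
    warpedMetric n f x v w = (f ‖x‖ / ‖x‖) ^ 2 * inner ℝ v w +
      (1 - (f ‖x‖ / ‖x‖) ^ 2) * (inner ℝ (radialField x) v * inner ℝ (radialField x) w) := by
  simp [warpedMetric, if_neg hx, euclForm_apply]

theorem warpedMetric_zero_apply (f : ℝ → ℝ) (v w : Euc n) :
    warpedMetric n f 0 v w = inner ℝ v w := by
  simp [warpedMetric, euclForm_apply]

theorem warpedMetric_symm (f : ℝ → ℝ) (x v w : Euc n) :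
    warpedMetric n f x v w = warpedMetric n f x w v := by
  rcases eq_or_ne x 0 with rfl | hx
  · rw [warpedMetric_zero_apply, warpedMetric_zero_apply, real_inner_comm]
  · rw [warpedMetric_apply f hx, warpedMetric_apply f hx, real_inner_comm]
    ring

theorem inner_radialField_sq_le (x v : Euc n) : inner ℝ (radialField x) v ^ 2 ≤ ‖v‖ ^ 2 := by
  rcases eq_or_ne x 0 with rfl | hx
  · simp [radialField]
  · have := abs_real_inner_le_norm (radialField x) v
    rw [norm_radialField hx, one_mul] at this
    rw [← sq_abs (inner ℝ _ _)]
    gcongr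

/-- The metric dominates `dt²`. -/
theorem inner_radialField_sq_le_warpedMetric (f : ℝ → ℝ) (x v : Euc n) :
    inner ℝ (radialField x) v ^ 2 ≤ warpedMetric n f x v v := by
  have h := inner_radialField_sq_le x v
  rcases eq_or_ne x 0 with rfl | hx
  · rwa [warpedMetric_zero_apply, real_inner_self_eq_norm_sq]
  · rw [warpedMetric_apply f hx, real_inner_self_eq_norm_sq]
    nlinarith [mul_nonneg (sq_nonneg (f ‖x‖ / ‖x‖)) (sub_nonneg.2 h)]

theorem le_warpedMetric {f : ℝ → ℝ} {x : Euc n} {c : ℝ} (hc1 : c ≤ 1)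
    (hc : x ≠ 0 → c ≤ (f ‖x‖ / ‖x‖) ^ 2) (v : Euc n) :
    c * ‖v‖ ^ 2 ≤ warpedMetric n f x v v := by
  have h := inner_radialField_sq_le x v
  rcases eq_or_ne x 0 with rfl | hx
  · rw [warpedMetric_zero_apply, real_inner_self_eq_norm_sq]
    nlinarith [sq_nonneg ‖v‖]
  · rw [warpedMetric_apply f hx, real_inner_self_eq_norm_sq]
    nlinarith [mul_nonneg (sub_nonneg.2 (hc hx)) (sub_nonneg.2 h),
      mul_nonneg (sub_nonneg.2 hc1) (sq_nonneg (inner ℝ (radialField x) v))]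

theorem warpedMetric_le {f : ℝ → ℝ} {x : Euc n} {c : ℝ} (hc1 : 1 ≤ c)
    (hc : x ≠ 0 → (f ‖x‖ / ‖x‖) ^ 2 ≤ c) (v : Euc n) :
    warpedMetric n f x v v ≤ c * ‖v‖ ^ 2 := by
  have h := inner_radialField_sq_le x v
  rcases eq_or_ne x 0 with rfl | hx
  · rw [warpedMetric_zero_apply, real_inner_self_eq_norm_sq]
    nlinarith [sq_nonneg ‖v‖]
  · rw [warpedMetric_apply f hx, real_inner_self_eq_norm_sq]
    nlinarith [mul_nonneg (sub_nonneg.2 (hc hx)) (sub_nonneg.2 h),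
      mul_nonneg (sub_nonneg.2 hc1) (sq_nonneg (inner ℝ (radialField x) v))]

theorem warpedMetric_pos {f : ℝ → ℝ} {x : Euc n} (hf : x ≠ 0 → f ‖x‖ ≠ 0) {v : Euc n}
    (hv : v ≠ 0) : 0 < warpedMetric n f x v v := by
  rcases eq_or_ne x 0 with rfl | hx
  · rw [warpedMetric_zero_apply]
    exact real_inner_self_pos.2 hv
  · have h1 : 0 < min 1 ((f ‖x‖ / ‖x‖) ^ 2) := by
      have := hf hx
      have := norm_ne_zero_iff.2 hx
      exact lt_min one_pos (by positivity)
    have h2 : 0 < ‖v‖ := norm_pos_iff.2 hv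
    exact (by positivity : 0 < min 1 ((f ‖x‖ / ‖x‖) ^ 2) * ‖v‖ ^ 2).trans_le
      (le_warpedMetric (min_le_left _ _) (fun _ => min_le_right _ _) v)

theorem IsWarping.ne_zero {κ : ℝ} {f : ℝ → ℝ} (hf : IsWarping κ f) {x : Euc n}
    (hx : x ∈ modelBall n κ) (hx0 : x ≠ 0) : f ‖x‖ ≠ 0 :=
  (hf.pos _ hx (norm_pos_iff.2 hx0)).ne'

theorem contDiffOn_warpedMetric_diff {κ : ℝ} {f : ℝ → ℝ}
    (hf : ContDiffOn ℝ ∞ f (modelInterval κ)) :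
    ContDiffOn ℝ ∞ (warpedMetric n f) (modelBall n κ \ {0}) := by
  have hne : ∀ x ∈ modelBall n κ \ {0}, ‖x‖ ≠ 0 := fun x hx => norm_ne_zero_iff.2 hx.2
  have hn : ContDiffOn ℝ ∞ (fun x : Euc n => ‖x‖) (modelBall n κ \ {0}) :=
    fun x hx => (contDiffAt_norm ℝ hx.2).contDiffWithinAt
  have hα : ContDiffOn ℝ ∞ (fun x : Euc n => (f ‖x‖ / ‖x‖) ^ 2) (modelBall n κ \ {0}) :=
    ((hf.comp hn fun x hx => hx.1).div hn hne).pow 2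
  have hr : ContDiffOn ℝ ∞ (fun x : Euc n => euclForm n (radialField x)) (modelBall n κ \ {0}) :=
    (euclForm n).contDiff.comp_contDiffOn ((hn.inv hne).smul contDiffOn_id)
  refine (contDiffOn_smul_const_add_smul (A := euclForm n) hα ((contDiffOn_const (c := (1 : ℝ))).sub hα)
    (hr.smulRight hr)).congr fun x hx => ?_
  simp only [warpedMetric, if_neg (show x ≠ 0 from hx.2)]

theorem isSmoothMetricOn_diff {κ : ℝ} {f : ℝ → ℝ} (hf : IsWarping κ f) :
    IsSmoothMetricOn (warpedMetric n f) (modelBall n κ \ {0}) where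
  smooth := contDiffOn_warpedMetric_diff hf.smooth
  symm x _ := warpedMetric_symm f x
  pos _ hx _ := warpedMetric_pos (hf.ne_zero hx.1)

/-- At the origin: `f(t)/t → 1`, and the radial projections `∂_t ⊗ ∂_t` are bounded. -/
theorem continuousOn_warpedMetric {κ : ℝ} {f : ℝ → ℝ} (hf : IsWarping κ f) :
    ContinuousOn (warpedMetric n f) (modelBall n κ) := by
  have hJ := isStarDomain_modelInterval κ
  intro x hx
  rcases eq_or_ne x 0 with rfl | hx0
  · set M := radialAverage 0 (derivWithin f (modelInterval κ)) with hM
    have hM0 : M 0 = 1 := by simp [hM, hf.deriv_zero]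
    have hMc : ContinuousOn M (modelInterval κ) := (contDiffOn_radialAverage hJ
      (hf.smooth.derivWithin hJ.uniqueDiffOn (m := ∞) (by simp)) 0).continuousOn
    have hMn : ContinuousWithinAt (fun x : Euc n => M ‖x‖) (modelBall n κ) 0 :=
      ContinuousWithinAt.comp (t := modelInterval κ) (hMc _ hx) continuous_norm.continuousWithinAt
        fun y hy => hy
    have hlim : Tendsto (fun x : Euc n => M ‖x‖ ^ 2) (𝓝[modelBall n κ] 0) (𝓝 1) := by
      have := hMn.tendsto.pow 2
      simpa [hM0] using this
    have h4 := tendsto_smul_const_add_smul (A := euclForm n) hlim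
      (B := fun x => (euclForm n (radialField x)).smulRight (euclForm n (radialField x))) (by
      intro y
      have hr : ‖euclForm n (radialField y)‖ ≤ 1 := by
        rw [euclForm, innerSL_apply_norm]
        rcases eq_or_ne y 0 with rfl | hy
        · simp [radialField]
        · exact (norm_radialField hy).le
      rw [ContinuousLinearMap.norm_smulRight_apply]
      exact mul_le_one₀ hr (norm_nonneg _) hr)
    have h5 : warpedMetric n f 0 = euclForm n := by simp [warpedMetric]
    rw [ContinuousWithinAt, h5]
    refine h4.congr' ?_
    filter_upwards [self_mem_nhdsWithin] with y hy
    rcases eq_or_ne y 0 with rfl | hy0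
    · ext v w
      simp [warpedMetric_zero_apply, euclForm_apply, hM0]
    · have := mul_radialAverage_derivWithin hJ hf.smooth hy
      rw [hf.zero, sub_zero] at this
      simp only [warpedMetric, if_neg hy0]
      rw [← this, mul_div_cancel_left₀ _ (norm_ne_zero_iff.2 hy0)]
  · have h := (contDiffOn_warpedMetric_diff (n := n) hf.smooth).continuousOn x ⟨hx, hx0⟩
    refine h.mono_of_mem_nhdsWithin ?_
    filter_upwards [self_mem_nhdsWithin,
      mem_nhdsWithin_of_mem_nhds (isOpen_ne.mem_nhds hx0)] with y h1 h2
    exact ⟨h1, h2⟩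

theorem isSmoothMetricOn_of_hasSmoothOddExtension {κ : ℝ} {f : ℝ → ℝ} (hf : IsWarping κ f)
    (hodd : HasSmoothOddExtension κ f) : IsSmoothMetricOn (warpedMetric n f) (modelBall n κ) := by
  refine ⟨?_, fun x _ => warpedMetric_symm f x, fun x hx v hv => warpedMetric_pos (hf.ne_zero hx) hv⟩
  obtain ⟨H, hH, hHodd, heq⟩ := hodd
  have hJ := isStarDomain_symmInterval κ
  have hH' := hH.derivWithin hJ.uniqueDiffOn (m := ∞) (by simp)
  -- `f(t) = t h(t)` and `1 - h(t)² = t² k(t)` with `h` and `k` even and smooth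
  set h := radialAverage 0 (derivWithin H (symmInterval κ)) with hh
  have hhs : ContDiffOn ℝ ∞ h (symmInterval κ) := contDiffOn_radialAverage hJ hH' 0
  have hheven : ∀ t, h (-t) = h t :=
    radialAverage_even (derivWithin_even_of_odd neg_mem_symmInterval hHodd) 0
  have hh0 : h 0 = 1 := by
    rw [hh, radialAverage_zero_right,
      derivWithin_symmInterval hH heq (zero_mem_modelInterval κ), hf.deriv_zero]
  have hes : ContDiffOn ℝ ∞ (fun t => 1 - h t ^ 2) (symmInterval κ) :=
    contDiffOn_const.sub (hhs.pow 2)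
  have heeven : ∀ t, (fun t => 1 - h t ^ 2) (-t) = (fun t => 1 - h t ^ 2) t := by simp [hheven]
  have he0 : derivWithin (fun t => 1 - h t ^ 2) (symmInterval κ) 0 = 0 := by
    have := derivWithin_odd_of_even neg_mem_symmInterval (w := fun t => 1 - h t ^ 2) heeven 0
      (J := symmInterval κ)
    rw [neg_zero] at this
    linarith
  obtain ⟨k, hk, hke, hkeven⟩ := exists_smooth_sq_mul hJ hes (by simp [hh0]) he0
  have hA := contDiffOn_comp_norm (n := n) (hhs.pow 2) (by simp [hheven])
  have hB := contDiffOn_comp_norm (n := n) hk (hkeven neg_mem_symmInterval heeven)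
  have hE : ContDiffOn ℝ ∞ (fun x : Euc n => euclForm n x) (modelBall n κ) :=
    (euclForm n).contDiff.contDiffOn
  refine (contDiffOn_smul_const_add_smul (A := euclForm n) hA hB (hE.smulRight hE)).congr
    fun x hx => ?_
  rcases eq_or_ne x 0 with rfl | hx0
  · ext v w
    rw [warpedMetric_zero_apply]
    simp only [norm_zero, hh0, add_apply, smul_apply,
      ContinuousLinearMap.smulRight_apply, euclForm_apply, inner_zero_left]
    simp
  · have hx' : ‖x‖ ≠ 0 := norm_ne_zero_iff.2 hx0
    have h1 := mul_radialAverage_derivWithin hJ hH (norm_mem_symmInterval hx)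
    rw [heq (zero_mem_modelInterval κ), hf.zero, sub_zero, heq hx, ← hh] at h1
    have h2 := hke _ (norm_mem_symmInterval hx)
    ext v w
    rw [warpedMetric_apply f hx0, ← h1, mul_div_cancel_left₀ _ hx', h2]
    simp [euclForm_apply, radialField, inner_smul_left]
    field_simp

/-! ### The Levi-Civita connection and the curvatures -/

theorem sum_smul_stdVec (z : Euc n) : ∑ i, z i • stdVec i = z := by
  ext j
  simp [stdVec, Finset.sum_apply, Pi.single_apply]

theorem metricMatrix_mulVec {g : BilinField n} {x : Euc n} (z : Euc n) (l : Fin n) :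
    (metricMatrix g x).mulVec (fun i => z i) l = g x (stdVec l) z := by
  conv_rhs => rw [← sum_smul_stdVec z]
  simp [Matrix.mulVec, dotProduct, metricMatrix, mul_comm]

theorem isUnit_metricMatrix {g : BilinField n} {x : Euc n} (hpos : ∀ v, v ≠ 0 → 0 < g x v v) :
    IsUnit (metricMatrix g x) := by
  rw [← Matrix.mulVec_injective_iff_isUnit, ← Matrix.coe_mulVecLin, ← LinearMap.ker_eq_bot,
    LinearMap.ker_eq_bot']
  intro z hz
  rw [Matrix.mulVecLin_apply] at hz
  by_contra hne
  have h0 : (WithLp.toLp 2 z : Euc n) ≠ 0 := fun h => hne (by simpa using h)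
  refine (hpos _ h0).ne' ?_
  have h1 : ∀ l, g x (stdVec l) (WithLp.toLp 2 z) = 0 := fun l => by
    rw [← metricMatrix_mulVec]
    exact congrFun hz l
  have h2 : g x (∑ i, z i • stdVec i) (WithLp.toLp 2 z) = 0 := by
    rw [map_sum, sum_apply]
    exact Finset.sum_eq_zero fun i _ => by simp [h1]
  have h3 := sum_smul_stdVec (WithLp.toLp 2 z)
  simp only at h3
  rwa [h3] at h2

/-- The Levi-Civita connection is determined by its pairings with constant fields, as `(g_{ij})` is
invertible. -/
theorem christoffel_eq {g : BilinField n} {x u v z : Euc n} (hpos : ∀ v, v ≠ 0 → 0 < g x v v)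
    (hz : ∀ w, g x w z = christoffelLower g x u v w) : christoffel g x u v = z := by
  have hdet : IsUnit (metricMatrix g x).det :=
    (Matrix.isUnit_iff_isUnit_det _).1 (isUnit_metricMatrix hpos)
  have h : ∀ k, ∑ l, (metricMatrix g x)⁻¹ k l * christoffelLower g x u v (stdVec l) = z k := by
    intro k
    have h1 : (fun l => christoffelLower g x u v (stdVec l)) =
        (metricMatrix g x).mulVec (fun i => z i) := by
      ext l
      rw [metricMatrix_mulVec, hz]
    have h2 : (metricMatrix g x)⁻¹.mulVec (fun l => christoffelLower g x u v (stdVec l)) k =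
        z k := by
      rw [h1, Matrix.mulVec_mulVec, Matrix.nonsing_inv_mul _ hdet, Matrix.one_mulVec]
    exact h2
  rw [christoffel]
  simp only [h]
  exact sum_smul_stdVec z

theorem inner_radialField_self {x : Euc n} (hx : x ≠ 0) :
    inner ℝ (radialField x) (radialField x) = (1 : ℝ) := by
  rw [real_inner_self_eq_norm_sq, norm_radialField hx, one_pow]

theorem inner_stdVec (z : Euc n) (i : Fin n) : inner ℝ z (stdVec i) = z i := by
  simp [stdVec, EuclideanSpace.inner_single_right]

theorem hasFDerivAt_radialFn {φ : ℝ → ℝ} {φ' : ℝ} {x : Euc n} (hx : x ≠ 0)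
    (hφ : HasDerivAt φ φ' ‖x‖) :
    HasFDerivAt (fun y : Euc n => φ ‖y‖) (φ' • euclForm n (radialField x)) x := by
  have h := hφ.comp_hasFDerivAt x (hasFDerivAt_norm_of_ne_zero hx)
  refine h.congr_fderiv ?_
  rw [radialField, map_smul]

/-- The derivative of the radial field: `1/|x|` times the projection onto the tangent space
of the sphere. -/
def radialDeriv (x : Euc n) : Euc n →L[ℝ] Euc n :=
  ‖x‖⁻¹ • (ContinuousLinearMap.id ℝ (Euc n) -
    (euclForm n (radialField x)).smulRight (radialField x))

theorem radialDeriv_apply (x u : Euc n) : radialDeriv x u =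
    ‖x‖⁻¹ • (u - inner ℝ (radialField x) u • radialField x) := by
  simp [radialDeriv, euclForm_apply]

theorem hasFDerivAt_radialField {x : Euc n} (hx : x ≠ 0) :
    HasFDerivAt (radialField : Euc n → Euc n) (radialDeriv x) x := by
  have hx' : ‖x‖ ≠ 0 := norm_ne_zero_iff.2 hx
  have h := (hasFDerivAt_radialFn hx (hasDerivAt_inv hx')).smul (hasFDerivAt_id x)
  refine h.congr_fderiv ?_
  ext1 u
  rw [radialDeriv_apply]
  simp only [add_apply, smul_apply, ContinuousLinearMap.smulRight_apply,
    ContinuousLinearMap.id_apply, euclForm_apply, id, smul_eq_mul]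
  have h1 : (-(‖x‖ ^ 2)⁻¹ * inner ℝ (radialField x) u) • x =
      -(‖x‖⁻¹ * inner ℝ (radialField x) u) • radialField x := by
    conv_rhs => rw [radialField, smul_smul]
    congr 1
    simp only [radialField, real_inner_smul_left]
    field_simp
  rw [h1]
  module

theorem hasFDerivAt_inner_radialField {x : Euc n} (hx : x ≠ 0) (a : Euc n) :
    HasFDerivAt (fun y : Euc n => inner ℝ (radialField y) a)
      ((euclForm n a).comp (radialDeriv x)) x := by
  have h := (euclForm n a).hasFDerivAt.comp x (hasFDerivAt_radialField hx)
  refine h.congr_of_eventuallyEq (Eventually.of_forall fun y => ?_)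
  simp only [Function.comp_def, euclForm_apply]
  exact real_inner_comm _ _

theorem comp_radialDeriv_apply {x : Euc n} (a u : Euc n) :
    (euclForm n a).comp (radialDeriv x) u =
      ‖x‖⁻¹ * (inner ℝ u a - inner ℝ (radialField x) u * inner ℝ (radialField x) a) := by
  rw [ContinuousLinearMap.comp_apply, radialDeriv_apply, euclForm_apply, real_inner_smul_right,
    inner_sub_right, real_inner_smul_right, real_inner_comm u a, real_inner_comm a (radialField x)]

theorem fderiv_warpedMetric {f : ℝ → ℝ} {f' : ℝ} {x : Euc n} (hx : x ≠ 0)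
    (hf : HasDerivAt f f' ‖x‖) (v w u : Euc n) :
    fderiv ℝ (fun y => warpedMetric n f y v w) x u =
      2 * (f ‖x‖ / ‖x‖) * (f' / ‖x‖ - f ‖x‖ / ‖x‖ ^ 2) * inner ℝ (radialField x) u *
        (inner ℝ v w - inner ℝ (radialField x) v * inner ℝ (radialField x) w) +
      (1 - (f ‖x‖ / ‖x‖) ^ 2) * ‖x‖⁻¹ *
        ((inner ℝ u v - inner ℝ (radialField x) u * inner ℝ (radialField x) v) *
            inner ℝ (radialField x) w +
          inner ℝ (radialField x) v *
            (inner ℝ u w - inner ℝ (radialField x) u * inner ℝ (radialField x) w)) := by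
  have hx' : ‖x‖ ≠ 0 := norm_ne_zero_iff.2 hx
  have hα : HasFDerivAt (fun y : Euc n => (f ‖y‖ / ‖y‖) ^ 2)
      ((2 * (f ‖x‖ / ‖x‖) * (f' / ‖x‖ - f ‖x‖ / ‖x‖ ^ 2)) • euclForm n (radialField x)) x := by
    refine hasFDerivAt_radialFn (φ := fun t => (f t / t) ^ 2) hx
      (((hf.div (hasDerivAt_id ‖x‖) hx').pow 2).congr_deriv ?_)
    simp only [id, Pi.div_apply, Nat.add_one_sub_one, pow_one]
    push_cast
    field_simp
  have hv := hasFDerivAt_inner_radialField hx v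
  have hw := hasFDerivAt_inner_radialField hx w
  have h := (hα.mul_const (inner ℝ v w)).add ((hα.const_sub 1).mul (hv.mul hw))
  have hev : (fun y => warpedMetric n f y v w) =ᶠ[𝓝 x] fun y => (f ‖y‖ / ‖y‖) ^ 2 * inner ℝ v w +
      (1 - (f ‖y‖ / ‖y‖) ^ 2) * (inner ℝ (radialField y) v * inner ℝ (radialField y) w) := by
    filter_upwards [isOpen_ne.mem_nhds hx] with y hy
    exact warpedMetric_apply f hy v w
  rw [(h.congr_of_eventuallyEq hev).fderiv]
  simp only [add_apply, smul_apply, neg_apply, comp_radialDeriv_apply, euclForm_apply, smul_eq_mul,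
    Pi.mul_apply]
  ring

/-- The Christoffel symbols of a rotationally symmetric metric:
`Γ(u,v) = P (u_r v + v_r u - 2 u_r v_r ∂_t) + Q (⟨u,v⟩ - u_r v_r) ∂_t`, where `u_r`, `v_r` are
the radial components. -/
def radialChristoffel (P Q : ℝ) (x u v : Euc n) : Euc n :=
  P • (inner ℝ (radialField x) u • v + inner ℝ (radialField x) v • u -
    (2 * (inner ℝ (radialField x) u * inner ℝ (radialField x) v)) • radialField x) +
  (Q * (inner ℝ u v - inner ℝ (radialField x) u * inner ℝ (radialField x) v)) • radialField x

theorem christoffel_warpedMetric {f : ℝ → ℝ} {f' : ℝ} {x : Euc n} (hx : x ≠ 0)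
    (hf : HasDerivAt f f' ‖x‖) (hf0 : f ‖x‖ ≠ 0) (u v : Euc n) :
    christoffel (warpedMetric n f) x u v =
      radialChristoffel (f' / f ‖x‖ - 1 / ‖x‖) (1 / ‖x‖ - f ‖x‖ * f' / ‖x‖ ^ 2) x u v := by
  have hx' : ‖x‖ ≠ 0 := norm_ne_zero_iff.2 hx
  refine christoffel_eq (fun v hv => warpedMetric_pos (fun _ => hf0) hv) fun w => ?_
  simp only [christoffelLower, fderiv_warpedMetric hx hf]
  rw [warpedMetric_apply f hx]
  simp only [radialChristoffel, inner_add_right, inner_sub_right, real_inner_smul_right,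
    inner_radialField_self hx]
  rw [real_inner_comm v w, real_inner_comm u w, real_inner_comm (radialField x) w,
    real_inner_comm u v]
  field_simp
  ring

theorem inner_radialField_radialChristoffel {P Q : ℝ} {x : Euc n} (hx : x ≠ 0) (u v : Euc n) :
    inner ℝ (radialField x) (radialChristoffel P Q x u v) =
      Q * (inner ℝ u v - inner ℝ (radialField x) u * inner ℝ (radialField x) v) := by
  simp only [radialChristoffel, inner_add_right, inner_sub_right, real_inner_smul_right,
    inner_radialField_self hx]
  ring

/-- Only the radial component of the derivative of the connection enters the radial curvatures; the
derivative of `P` drops out of it. -/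
theorem inner_fderiv_radialChristoffel {P Q : ℝ → ℝ} {P' Q' : ℝ} {x : Euc n} (hx : x ≠ 0)
    (hP : HasDerivAt P P' ‖x‖) (hQ : HasDerivAt Q Q' ‖x‖) (a b d : Euc n) :
    inner ℝ (radialField x) (fderiv ℝ (fun y => radialChristoffel (P ‖y‖) (Q ‖y‖) y a b) x d) =
      Q' * inner ℝ (radialField x) d *
        (inner ℝ a b - inner ℝ (radialField x) a * inner ℝ (radialField x) b) -
      (P ‖x‖ + Q ‖x‖) * ‖x‖⁻¹ *
        ((inner ℝ d a - inner ℝ (radialField x) d * inner ℝ (radialField x) a) *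
            inner ℝ (radialField x) b +
          inner ℝ (radialField x) a *
            (inner ℝ d b - inner ℝ (radialField x) d * inner ℝ (radialField x) b)) := by
  have hP' := hasFDerivAt_radialFn hx hP
  have hQ' := hasFDerivAt_radialFn hx hQ
  have ha := hasFDerivAt_inner_radialField hx a
  have hb := hasFDerivAt_inner_radialField hx b
  have hr := hasFDerivAt_radialField hx
  have h := (hP'.smul (((ha.smul_const b).add (hb.smul_const a)).sub
    (((ha.mul hb).const_mul 2).smul hr))).add
    ((hQ'.mul ((ha.mul hb).const_sub (inner ℝ a b))).smul hr)
  have h' : HasFDerivAt (fun y => radialChristoffel (P ‖y‖) (Q ‖y‖) y a b) _ x := h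
  rw [h'.fderiv]
  simp only [add_apply, sub_apply, smul_apply, neg_apply, comp_radialDeriv_apply, euclForm_apply,
    smul_eq_mul, radialDeriv_apply, ContinuousLinearMap.smulRight_apply, inner_add_right,
    inner_sub_right, real_inner_smul_right, inner_radialField_self hx, Pi.mul_apply, Pi.add_apply,
    Pi.sub_apply, Pi.smul_apply']
  ring

theorem covDeriv_christoffel_radial {f f₁ : ℝ → ℝ} {x : Euc n} (hx : x ≠ 0)
    (hf : ∀ᶠ s in 𝓝 ‖x‖, HasDerivAt f (f₁ s) s) (hf0 : f ‖x‖ ≠ 0)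
    (a b d : Euc n) :
    inner ℝ (radialField x)
      (covDeriv (warpedMetric n f) (fun y => christoffel (warpedMetric n f) y a b) x d) =
      inner ℝ (radialField x) (fderiv ℝ (fun y => radialChristoffel (f₁ ‖y‖ / f ‖y‖ - 1 / ‖y‖)
        (1 / ‖y‖ - f ‖y‖ * f₁ ‖y‖ / ‖y‖ ^ 2) y a b) x d) +
      inner ℝ (radialField x) (radialChristoffel (f₁ ‖x‖ / f ‖x‖ - 1 / ‖x‖)
        (1 / ‖x‖ - f ‖x‖ * f₁ ‖x‖ / ‖x‖ ^ 2) x d (radialChristoffel (f₁ ‖x‖ / f ‖x‖ - 1 / ‖x‖)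
        (1 / ‖x‖ - f ‖x‖ * f₁ ‖x‖ / ‖x‖ ^ 2) x a b)) := by
  have hx1 := hf.self_of_nhds
  have hev : (fun y => christoffel (warpedMetric n f) y a b) =ᶠ[𝓝 x] fun y =>
      radialChristoffel (f₁ ‖y‖ / f ‖y‖ - 1 / ‖y‖) (1 / ‖y‖ - f ‖y‖ * f₁ ‖y‖ / ‖y‖ ^ 2) y a b := by
    have h1 : ∀ᶠ y in 𝓝 x, HasDerivAt f (f₁ ‖y‖) ‖y‖ :=
      continuous_norm.continuousAt.eventually hf
    have h2 : ∀ᶠ y in 𝓝 x, f ‖y‖ ≠ 0 :=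
      continuous_norm.continuousAt.eventually (hx1.continuousAt.eventually_ne hf0)
    filter_upwards [h1, h2, isOpen_ne.mem_nhds hx] with y hy1 hy2 hy3
    exact christoffel_warpedMetric hy3 hy1 hy2 a b
  rw [covDeriv, hev.fderiv_eq, inner_add_right, christoffel_warpedMetric hx hx1 hf0,
    christoffel_warpedMetric hx hx1 hf0]

theorem sectionalCurvature_warpedMetric {f f₁ : ℝ → ℝ} {f₂ : ℝ} {x v : Euc n} (hx : x ≠ 0)
    (hf : ∀ᶠ s in 𝓝 ‖x‖, HasDerivAt f (f₁ s) s) (hf₁ : HasDerivAt f₁ f₂ ‖x‖) (hf0 : f ‖x‖ ≠ 0)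
    (hv : v ≠ 0) (hrv : warpedMetric n f x (radialField x) v = 0) :
    sectionalCurvature (warpedMetric n f) x (radialField x) v = -f₂ / f ‖x‖ := by
  have hx' : ‖x‖ ≠ 0 := norm_ne_zero_iff.2 hx
  have hvn : ‖v‖ ≠ 0 := norm_ne_zero_iff.2 hv
  have hrv' : inner ℝ (radialField x) v = (0 : ℝ) := by
    rw [← warpedMetric_radialField n f x v hx, hrv]
  have hx1 := hf.self_of_nhds
  have hP : HasDerivAt (fun t => f₁ t / f t - 1 / t) _ ‖x‖ :=
    (hf₁.div hx1 hf0).sub ((hasDerivAt_const ‖x‖ (1 : ℝ)).div (hasDerivAt_id ‖x‖) hx')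
  have hQ : HasDerivAt (fun t => 1 / t - f t * f₁ t / t ^ 2) _ ‖x‖ :=
    ((hasDerivAt_const ‖x‖ (1 : ℝ)).div (hasDerivAt_id ‖x‖) hx').sub
      ((hx1.mul hf₁).div ((hasDerivAt_id ‖x‖).pow 2) (pow_ne_zero 2 hx'))
  rw [sectionalCurvature, warpedMetric_symm, warpedMetric_radialField n f x _ hx, hrv,
    warpedMetric_radialField n f x _ hx, inner_radialField_self hx, warpedMetric_apply f hx,
    hrv', curvatureTensor, inner_sub_right, covDeriv_christoffel_radial hx hf hf0,
    covDeriv_christoffel_radial hx hf hf0, inner_fderiv_radialChristoffel hx hP hQ,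
    inner_fderiv_radialChristoffel hx hP hQ, inner_radialField_radialChristoffel hx,
    inner_radialField_radialChristoffel hx]
  have hvr' : inner ℝ v (radialField x) = (0 : ℝ) := by rw [real_inner_comm, hrv']
  simp only [radialChristoffel, hrv', hvr', inner_radialField_self hx, inner_add_right,
    inner_sub_right, real_inner_smul_right, real_inner_self_eq_norm_sq, Pi.mul_apply,
    id]
  field_simp
  ring

theorem sphereMeanCurvature_warpedMetric {f : ℝ → ℝ} {f' : ℝ} {x : Euc n} (hx : x ≠ 0)
    (hf : HasDerivAt f f' ‖x‖) (hf0 : f ‖x‖ ≠ 0) :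
    sphereMeanCurvature (warpedMetric n f) x = ((n : ℝ) - 1) * (f' / f ‖x‖) := by
  have hx' : ‖x‖ ≠ 0 := norm_ne_zero_iff.2 hx
  have hN : fderiv ℝ (fun y : Euc n => -radialField y) x = -radialDeriv x :=
    (hasFDerivAt_radialField hx).neg.fderiv
  have hcov : ∀ w : Euc n, inner ℝ (radialField x) w = (0 : ℝ) →
      -covDeriv (warpedMetric n f) (fun y => -radialField y) x w = (f' / f ‖x‖) • w := by
    intro w hw
    have hw' : inner ℝ w (radialField x) = (0 : ℝ) := by rw [real_inner_comm, hw]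
    rw [covDeriv, hN, christoffel_warpedMetric hx hf hf0, neg_apply, radialDeriv_apply,
      radialChristoffel]
    simp only [inner_neg_right, hw, hw', inner_radialField_self hx]
    module
  have hg : ∀ i : Fin n, warpedMetric n f x (stdVec i) (-radialField x) = -radialField x i := by
    intro i
    rw [map_neg, warpedMetric_symm, warpedMetric_radialField n f x _ hx, inner_stdVec]
  have hterm : ∀ i : Fin n, (-covDeriv (warpedMetric n f) (fun y => -radialField y) x
      (stdVec i - warpedMetric n f x (stdVec i) (-radialField x) • -radialField x)) i =
      (f' / f ‖x‖) * (1 - radialField x i ^ 2) := by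
    intro i
    rw [hg, hcov]
    · simp only [smul_neg, neg_smul, neg_neg, PiLp.smul_apply, PiLp.sub_apply, smul_eq_mul]
      simp only [stdVec, PiLp.single_apply, if_true]
      ring
    · rw [smul_neg, neg_smul, neg_neg, inner_sub_right, real_inner_smul_right,
        inner_radialField_self hx, inner_stdVec, mul_one, sub_self]
  rw [sphereMeanCurvature, meanCurvature, Finset.sum_congr rfl fun i _ => hterm i,
    ← Finset.mul_sum, Finset.sum_sub_distrib, ← EuclideanSpace.real_norm_sq_eq,
    norm_radialField hx]
  simp
  ring

/-! ### Distance and completeness -/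

theorem enorm_sub_le_lintegral {F : Type*} [NormedAddCommGroup F] [NormedSpace ℝ F]
    [CompleteSpace F] {φ : ℝ → F} {L : ℝ → ℝ} (hφ : ContDiffOn ℝ 1 φ (Icc 0 1))
    (hL : ∀ t ∈ Icc (0 : ℝ) 1, ‖derivWithin φ (Icc 0 1) t‖ ≤ L t) {a b : ℝ}
    (ha : 0 ≤ a) (hab : a ≤ b) (hb : b ≤ 1) :
    ‖φ b - φ a‖ₑ ≤ ∫⁻ t in Icc (0 : ℝ) 1, ENNReal.ofReal (L t) := by
  have hu : UniqueDiffOn ℝ (Icc (0 : ℝ) 1) := uniqueDiffOn_Icc zero_lt_one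
  have hsub : Icc a b ⊆ Icc 0 1 := Icc_subset_Icc ha hb
  have hc : ContinuousOn (derivWithin φ (Icc 0 1)) (Icc 0 1) :=
    hφ.continuousOn_derivWithin hu le_rfl
  have hd : ∀ t ∈ Ioo a b, HasDerivAt φ (derivWithin φ (Icc 0 1) t) t := fun t ht =>
    (hφ.differentiableOn one_ne_zero t (hsub ⟨ht.1.le, ht.2.le⟩)).hasDerivWithinAt.hasDerivAt
      (Icc_mem_nhds (ha.trans_lt ht.1) (ht.2.trans_le hb))
  have hi : IntervalIntegrable (derivWithin φ (Icc 0 1)) volume a b := by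
    refine (hc.mono ?_).intervalIntegrable
    rwa [uIcc_of_le hab]
  rw [← intervalIntegral.integral_eq_sub_of_hasDerivAt_of_le hab (hφ.continuousOn.mono hsub) hd hi,
    intervalIntegral.integral_of_le hab]
  calc ‖∫ t in Ioc a b, derivWithin φ (Icc 0 1) t‖ₑ
      ≤ ∫⁻ t in Ioc a b, ‖derivWithin φ (Icc 0 1) t‖ₑ := enorm_integral_le_lintegral_enorm _
    _ ≤ ∫⁻ t in Ioc a b, ENNReal.ofReal (L t) := by
        refine setLIntegral_mono' measurableSet_Ioc fun t ht => ?_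
        rw [← ofReal_norm]
        exact ENNReal.ofReal_le_ofReal (hL t (hsub ⟨ht.1.le, ht.2⟩))
    _ ≤ ∫⁻ t in Icc (0 : ℝ) 1, ENNReal.ofReal (L t) :=
        lintegral_mono_set (Ioc_subset_Icc_self.trans hsub)

/-- Along a curve the radius varies by at most the length. -/
theorem enorm_norm_sub_norm_le_curveLength (f : ℝ → ℝ) {γ : ℝ → Euc n}
    (hγ : ContDiffOn ℝ 1 γ (Icc 0 1)) {a b : ℝ} (ha : 0 ≤ a) (hab : a ≤ b) (hb : b ≤ 1) :
    ‖‖γ b‖ - ‖γ a‖‖ₑ ≤ curveLength (warpedMetric n f) γ := by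
  have hu : UniqueDiffOn ℝ (Icc (0 : ℝ) 1) := uniqueDiffOn_Icc zero_lt_one
  -- the norm is not differentiable where the curve meets the origin: regularize it
  have key : ∀ ε : ℝ, 0 < ε → ‖√(ε ^ 2 + ‖γ b‖ ^ 2) - √(ε ^ 2 + ‖γ a‖ ^ 2)‖ₑ ≤
      curveLength (warpedMetric n f) γ := by
    intro ε hε
    have hpos : ∀ y : Euc n, 0 < ε ^ 2 + ‖y‖ ^ 2 := fun y => by positivity
    have hφ : ContDiffOn ℝ 1 (fun t => √(ε ^ 2 + ‖γ t‖ ^ 2)) (Icc 0 1) :=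
      (contDiffOn_const.add (hγ.norm_sq ℝ)).sqrt fun t _ => (hpos (γ t)).ne'
    refine enorm_sub_le_lintegral hφ (fun t ht => ?_) ha hab hb
    set v := derivWithin γ (Icc 0 1) t with hv
    have hγ' : HasDerivWithinAt γ v (Icc 0 1) t :=
      (hγ.differentiableOn one_ne_zero t ht).hasDerivWithinAt
    have h1 := ((hγ'.norm_sq).const_add (ε ^ 2)).sqrt (hpos (γ t)).ne'
    rw [h1.derivWithin (hu t ht)]
    refine le_trans ?_ (Real.abs_le_sqrt (inner_radialField_sq_le_warpedMetric f (γ t) v))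
    rw [mul_div_mul_left _ _ two_ne_zero, Real.norm_eq_abs, abs_div,
      abs_of_pos (Real.sqrt_pos.2 (hpos (γ t)))]
    rcases eq_or_ne (γ t) 0 with h0 | h0
    · simp [h0]
    · rw [radialField, real_inner_smul_left, abs_mul, abs_inv, abs_norm, div_eq_inv_mul]
      refine mul_le_mul_of_nonneg_right (inv_anti₀ (norm_pos_iff.2 h0) ?_) (abs_nonneg _)
      exact Real.le_sqrt_of_sq_le (by nlinarith)
  have hlim : Tendsto (fun ε : ℝ => ‖√(ε ^ 2 + ‖γ b‖ ^ 2) - √(ε ^ 2 + ‖γ a‖ ^ 2)‖ₑ) (𝓝[>] 0)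
      (𝓝 ‖‖γ b‖ - ‖γ a‖‖ₑ) := by
    have hc : Continuous fun ε : ℝ => ‖√(ε ^ 2 + ‖γ b‖ ^ 2) - √(ε ^ 2 + ‖γ a‖ ^ 2)‖ₑ := by
      fun_prop
    have := hc.tendsto 0
    simp only [ne_eq, OfNat.ofNat_ne_zero, not_false_eq_true, zero_pow, zero_add,
      Real.sqrt_sq (norm_nonneg _)] at this
    exact this.mono_left nhdsWithin_le_nhds
  refine le_of_tendsto hlim ?_
  filter_upwards [self_mem_nhdsWithin] with ε hε
  exact key ε hε

theorem enorm_norm_sub_norm_le_metricDist (f : ℝ → ℝ) (Ω : Set (Euc n)) (x y : Euc n) :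
    ‖‖y‖ - ‖x‖‖ₑ ≤ metricDist (warpedMetric n f) Ω x y := by
  refine le_iInf₂ fun γ hγ => ?_
  have := enorm_norm_sub_norm_le_curveLength f hγ.1 le_rfl zero_le_one le_rfl
  rwa [hγ.2.2.1, hγ.2.2.2] at this

theorem contDiff_segment (x y : Euc n) : ContDiff ℝ 1 fun t : ℝ => x + t • (y - x) := by
  fun_prop

theorem curveLength_segment (g : BilinField n) (x y : Euc n) :
    curveLength g (fun t : ℝ => x + t • (y - x)) =
      ∫⁻ t in Icc (0 : ℝ) 1, ENNReal.ofReal (√(g (x + t • (y - x)) (y - x) (y - x))) := by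
  refine setLIntegral_congr_fun measurableSet_Icc fun t ht => ?_
  have h : HasDerivAt (fun t : ℝ => x + t • (y - x)) (y - x) t := by
    simpa using ((hasDerivAt_id t).smul_const (y - x)).const_add x
  simp only
  rw [h.hasDerivWithinAt.derivWithin (uniqueDiffOn_Icc zero_lt_one t ht)]

theorem metricDist_le_of_le {f : ℝ → ℝ} {Ω : Set (Euc n)} {x y : Euc n} {c : ℝ} (hc : 0 ≤ c)
    (hΩ : ∀ t ∈ Icc (0 : ℝ) 1, x + t • (y - x) ∈ Ω)
    (h : ∀ t ∈ Icc (0 : ℝ) 1,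
      warpedMetric n f (x + t • (y - x)) (y - x) (y - x) ≤ c * ‖y - x‖ ^ 2) :
    metricDist (warpedMetric n f) Ω x y ≤ ENNReal.ofReal (√c * ‖y - x‖) := by
  refine (iInf₂_le (fun t : ℝ => x + t • (y - x))
    ⟨(contDiff_segment x y).contDiffOn, hΩ, by simp, by simp⟩).trans ?_
  rw [curveLength_segment]
  calc ∫⁻ t in Icc (0 : ℝ) 1, ENNReal.ofReal
        (√(warpedMetric n f (x + t • (y - x)) (y - x) (y - x)))
      ≤ ∫⁻ _ in Icc (0 : ℝ) 1, ENNReal.ofReal (√c * ‖y - x‖) := by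
        refine setLIntegral_mono' measurableSet_Icc fun t ht => ENNReal.ofReal_le_ofReal ?_
        rw [← Real.sqrt_sq (norm_nonneg (y - x)), ← Real.sqrt_mul hc]
        exact Real.sqrt_le_sqrt (h t ht)
    _ = ENNReal.ofReal (√c * ‖y - x‖) := by simp

/-- The radial segment is minimizing. -/
theorem metricDist_zero_left (f : ℝ → ℝ) {κ : ℝ} {x : Euc n} (hx : x ∈ modelBall n κ) :
    metricDist (warpedMetric n f) (modelBall n κ) 0 x = ENNReal.ofReal ‖x‖ := by
  refine le_antisymm ?_ ?_
  · have h := metricDist_le_of_le (f := f) (Ω := modelBall n κ) (x := 0) (y := x) zero_le_one ?_ ?_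
    · simpa using h
    · intro t ht
      simp only [sub_zero, zero_add]
      rw [modelBall, mem_ofPred_eq, norm_smul, Real.norm_of_nonneg ht.1]
      exact mem_modelInterval_of_le hx (mul_nonneg ht.1 (norm_nonneg _))
        (mul_le_of_le_one_left (norm_nonneg _) ht.2)
    · intro t ht
      simp only [sub_zero, zero_add, one_mul]
      rcases eq_or_ne (t • x) 0 with h0 | h0
      · rw [h0, warpedMetric_zero_apply, real_inner_self_eq_norm_sq]
      · have ht0 : 0 < t := lt_of_le_of_ne ht.1 fun h => h0 (by rw [← h, zero_smul])
        have hx0 : x ≠ 0 := fun h => h0 (by rw [h, smul_zero])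
        have hr : radialField (t • x) = radialField x := by
          rw [radialField, radialField, norm_smul, Real.norm_of_nonneg ht.1, smul_smul, mul_inv]
          congr 1
          field_simp
        have hi : inner ℝ (radialField x) x = ‖x‖ := by
          rw [radialField, real_inner_smul_left, real_inner_self_eq_norm_sq]
          have := norm_ne_zero_iff.2 hx0
          field_simp
        rw [warpedMetric_apply f h0, hr, hi, real_inner_self_eq_norm_sq]
        exact le_of_eq (by ring)
  · have := enorm_norm_sub_norm_le_metricDist f (modelBall n κ) 0 x
    rwa [norm_zero, sub_zero, ← ofReal_norm, norm_norm] at this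

/-- On bounded sets the metric is uniformly equivalent to the Euclidean one. -/
theorem exists_warpedMetric_bounds {f : ℝ → ℝ} (hf : IsWarping 0 f) (R : ℝ) :
    ∃ c C : ℝ, 0 < c ∧ 0 < C ∧ ∀ x : Euc n, ‖x‖ ≤ R → ∀ v,
      c * ‖v‖ ^ 2 ≤ warpedMetric n f x v v ∧ warpedMetric n f x v v ≤ C * ‖v‖ ^ 2 := by
  have hI : ∀ t, 0 ≤ t → t ∈ modelInterval 0 := fun t => mem_modelInterval_of_nonpos le_rfl
  have hJ := isStarDomain_modelInterval 0
  rcases lt_or_ge R 0 with hR | hR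
  · exact ⟨1, 1, one_pos, one_pos, fun x hx => absurd (norm_nonneg x) (by linarith)⟩
  set M := radialAverage 0 (derivWithin f (modelInterval 0)) with hM
  have hMt : ∀ t, 0 < t → M t = f t / t := by
    intro t ht
    have := mul_radialAverage_derivWithin hJ hf.smooth (hI t ht.le)
    rw [hf.zero, sub_zero] at this
    rw [← this, mul_div_cancel_left₀ _ ht.ne']
  have hMpos : ∀ t, 0 ≤ t → 0 < M t ^ 2 := by
    intro t ht
    rcases ht.eq_or_lt with rfl | h
    · simp [hM, hf.deriv_zero]
    · rw [hMt t h]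
      have := hf.pos t (hI t ht) h
      positivity
  have hMc : ContinuousOn (fun t => M t ^ 2) (Icc 0 R) :=
    ((contDiffOn_radialAverage hJ (hf.smooth.derivWithin hJ.uniqueDiffOn (m := ∞) (by simp))
      0).continuousOn.mono fun t ht => hI t ht.1).pow 2
  obtain ⟨a, ha, hmin⟩ := isCompact_Icc.exists_isMinOn (nonempty_Icc.2 hR) hMc
  obtain ⟨b, hb, hmax⟩ := isCompact_Icc.exists_isMaxOn (nonempty_Icc.2 hR) hMc
  refine ⟨min 1 (M a ^ 2), max 1 (M b ^ 2), lt_min one_pos (hMpos a ha.1),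
    one_pos.trans_le (le_max_left _ _), fun x hx v => ⟨?_, ?_⟩⟩
  · refine le_warpedMetric (min_le_left _ _) (fun hx0 => (min_le_right _ _).trans ?_) v
    rw [← hMt _ (norm_pos_iff.2 hx0)]
    exact isMinOn_iff.1 hmin _ ⟨norm_nonneg x, hx⟩
  · refine warpedMetric_le (le_max_left _ _) (fun hx0 => le_trans ?_ (le_max_right _ _)) v
    rw [← hMt _ (norm_pos_iff.2 hx0)]
    exact isMaxOn_iff.1 hmax _ ⟨norm_nonneg x, hx⟩

/-- A curve of length less than `1` starting at `x` stays in the ball of radius `‖x‖ + 1`, where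
the metric is bounded below by a multiple of the Euclidean one. -/
theorem enorm_smul_sub_le_metricDist {f : ℝ → ℝ} {c R : ℝ} (hc : 0 ≤ c)
    (h : ∀ x : Euc n, ‖x‖ ≤ R → ∀ v, c * ‖v‖ ^ 2 ≤ warpedMetric n f x v v) {x y : Euc n}
    (hx : ‖x‖ + 1 ≤ R) (hd : metricDist (warpedMetric n f) univ x y < 1) :
    ‖√c • (y - x)‖ₑ ≤ metricDist (warpedMetric n f) univ x y := by
  by_contra! hlt
  obtain ⟨γ, hγ⟩ := iInf_lt_iff.1 (lt_min hd hlt)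
  obtain ⟨⟨hγ1, -, hγ0, hγe⟩, hlen⟩ := iInf_lt_iff.1 hγ
  have hball : ∀ t ∈ Icc (0 : ℝ) 1, ‖γ t‖ ≤ R := by
    intro t ht
    have h1 := (enorm_norm_sub_norm_le_curveLength f hγ1 le_rfl ht.1 ht.2).trans_lt
      (hlen.trans_le (min_le_left _ _))
    rw [← ofReal_norm, ENNReal.ofReal_lt_one, hγ0] at h1
    linarith [le_abs_self (‖γ t‖ - ‖x‖), Real.norm_eq_abs (‖γ t‖ - ‖x‖)]
  have h2 : ‖√c • γ 1 - √c • γ 0‖ₑ ≤ curveLength (warpedMetric n f) γ := by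
    refine enorm_sub_le_lintegral (φ := fun t => √c • γ t) (hγ1.const_smul √c)
      (fun t ht => ?_) le_rfl zero_le_one le_rfl
    have hd' := (hγ1.differentiableOn one_ne_zero t ht).hasDerivWithinAt.const_smul √c
    have hd2 : derivWithin (fun t => √c • γ t) (Icc 0 1) t = √c • derivWithin γ (Icc 0 1) t :=
      hd'.derivWithin (uniqueDiffOn_Icc zero_lt_one t ht)
    rw [hd2, norm_smul, Real.norm_of_nonneg (Real.sqrt_nonneg c),
      ← Real.sqrt_sq (norm_nonneg (derivWithin γ (Icc 0 1) t)), ← Real.sqrt_mul hc]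
    exact Real.sqrt_le_sqrt (h _ (hball t ht) _)
  rw [← smul_sub, hγ0, hγe] at h2
  exact absurd (h2.trans_lt (hlen.trans_le (min_le_right _ _))) (lt_irrefl _)

/-- A Cauchy sequence is bounded, hence Cauchy for the Euclidean distance, and Euclidean convergence
implies convergence for the Riemannian distance. -/
theorem isCompleteMetric_warpedMetric {f : ℝ → ℝ} (hf : IsWarping 0 f) :
    IsCompleteMetric (warpedMetric n f) := by
  intro u hu
  obtain ⟨N, hN⟩ := hu 1 one_pos
  have hbd : ∀ k ≥ N, ‖u k‖ ≤ ‖u N‖ + 1 := by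
    intro k hk
    have h1 := (enorm_norm_sub_norm_le_metricDist f univ (u N) (u k)).trans_lt (hN N le_rfl k hk)
    rw [← ofReal_norm, ENNReal.ofReal_lt_one] at h1
    linarith [le_abs_self (‖u k‖ - ‖u N‖), Real.norm_eq_abs (‖u k‖ - ‖u N‖)]
  obtain ⟨c, C, hc, hC, hcC⟩ := exists_warpedMetric_bounds (n := n) hf (‖u N‖ + 2)
  have hsc : 0 < √c := Real.sqrt_pos.2 hc
  have hcau : CauchySeq u := by
    rw [Metric.cauchySeq_iff]
    intro ε hε
    obtain ⟨N', hN'⟩ := hu (ENNReal.ofReal (√c * ε)) (ENNReal.ofReal_pos.2 (by positivity))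
    refine ⟨max N N', fun j hj k hk => ?_⟩
    have hj1 := (le_max_left _ _).trans hj
    have hk1 := (le_max_left _ _).trans hk
    have h1 := (enorm_smul_sub_le_metricDist hc.le (fun x hx v => (hcC x hx v).1)
      (by linarith [hbd k hk1]) (hN k hk1 j hj1)).trans_lt
      (hN' k ((le_max_right _ _).trans hk) j ((le_max_right _ _).trans hj))
    rw [← ofReal_norm, ENNReal.ofReal_lt_ofReal_iff (by positivity), norm_smul,
      Real.norm_of_nonneg hsc.le] at h1
    rw [dist_eq_norm]
    exact lt_of_mul_lt_mul_left h1 hsc.le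
  obtain ⟨x, hx⟩ := cauchySeq_tendsto_of_complete hcau
  have hxR : ‖x‖ ≤ ‖u N‖ + 2 := by
    refine le_of_tendsto hx.norm ?_
    filter_upwards [eventually_ge_atTop N] with k hk
    linarith [hbd k hk]
  refine ⟨x, fun ε hε => ?_⟩
  have hlim : Tendsto (fun k => ENNReal.ofReal (√C * ‖x - u k‖)) atTop (𝓝 0) := by
    have h1 : Tendsto (fun k => √C * ‖x - u k‖) atTop (𝓝 0) := by
      simpa using ((hx.const_sub x).norm).const_mul √C
    have h2 := (ENNReal.continuous_ofReal.tendsto 0).comp h1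
    rwa [ENNReal.ofReal_zero] at h2
  obtain ⟨N₁, hN₁⟩ := eventually_atTop.1 ((hlim.eventually_lt_const hε).and (eventually_ge_atTop N))
  refine ⟨N₁, fun k hk => lt_of_le_of_lt ?_ (hN₁ k hk).1⟩
  refine metricDist_le_of_le hC.le (fun _ _ => mem_univ _) fun t ht => (hcC _ ?_ _).2
  have hmem := (convex_closedBall (0 : Euc n) (‖u N‖ + 2)).add_smul_sub_mem
    (x := u k) (y := x) ?_ ?_ ht
  · simpa using hmem
  · simpa using by linarith [hbd k (hN₁ k hk).2]
  · simpa using hxR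

/-! ### Curvature comparison and the existence of complete examples -/

theorem symmInterval_zero : symmInterval 0 = univ :=
  eq_univ_of_forall fun t => mem_modelInterval_of_nonpos le_rfl (abs_nonneg t)

theorem modelBall_zero (n : ℕ) : modelBall n 0 = univ :=
  eq_univ_of_forall fun x => mem_modelInterval_of_nonpos le_rfl (norm_nonneg x)

theorem contDiff_integral {w : ℝ → ℝ} (hw : ContDiff ℝ ∞ w) :
    ContDiff ℝ ∞ fun t => ∫ s in (0 : ℝ)..t, w s := by
  rw [← contDiffOn_univ, ← symmInterval_zero]
  exact contDiffOn_integral (isStarDomain_symmInterval 0) hw.contDiffOn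

theorem hasDerivAt_integral {w : ℝ → ℝ} (hw : Continuous w) (t : ℝ) :
    HasDerivAt (fun t => ∫ s in (0 : ℝ)..t, w s) (w t) t :=
  intervalIntegral.integral_hasDerivAt_right (hw.intervalIntegrable _ _)
    (hw.stronglyMeasurableAtFilter _ _) hw.continuousAt

theorem integral_neg_of_even {w : ℝ → ℝ} (hw : ∀ t, w (-t) = w t) (t : ℝ) :
    ∫ s in (0 : ℝ)..-t, w s = -∫ s in (0 : ℝ)..t, w s := by
  simp only [← mul_radialAverage, radialAverage_even hw]
  ring

theorem integral_neg_of_odd {w : ℝ → ℝ} (hw : ∀ t, w (-t) = -w t) (t : ℝ) :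
    ∫ s in (0 : ℝ)..-t, w s = ∫ s in (0 : ℝ)..t, w s := by
  simp only [← mul_radialAverage, radialAverage_odd hw]
  ring

theorem IsAdmissible.congr {κ t₀ : ℝ} {ψ φ : ℝ → ℝ} (hψ : IsAdmissible κ t₀ ψ)
    (h : EqOn φ ψ (modelInterval κ)) : IsAdmissible κ t₀ φ := by
  have hd : ∀ t ∈ modelInterval κ,
      derivWithin φ (modelInterval κ) t = derivWithin ψ (modelInterval κ) t :=
    fun t ht => derivWithin_congr h (h ht)
  have hz := zero_mem_modelInterval κ
  exact ⟨hψ.smooth.congr h, (h hz).trans hψ.zero, (hd 0 hz).trans hψ.deriv_zero,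
    fun t ht => (h ht).trans_le (hψ.nonpos t ht), fun t ht ht0 => by
      rw [hd t ht]; exact hψ.deriv_pos t ht ht0⟩

theorem eqOn_comparisonFn {κ : ℝ} {f g : ℝ → ℝ} (h : EqOn f g (modelInterval κ)) :
    EqOn (comparisonFn κ f) (comparisonFn κ g) (modelInterval κ) := fun t ht => by
  rw [comparisonFn, comparisonFn, derivWithin_congr h (h ht), h ht]

/-- `T(t) = ∫₀ᵗ S_κ²`. -/
def modelT (κ t : ℝ) : ℝ := ∫ s in (0 : ℝ)..t, modelS κ s ^ 2

theorem hasDerivAt_modelT (κ t : ℝ) : HasDerivAt (modelT κ) (modelS κ t ^ 2) t :=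
  hasDerivAt_integral ((contDiff_modelS κ).continuous.pow 2) t

theorem contDiff_modelT (κ : ℝ) : ContDiff ℝ ∞ (modelT κ) :=
  contDiff_integral ((contDiff_modelS κ).pow 2)

theorem modelT_neg (κ t : ℝ) : modelT κ (-t) = -modelT κ t :=
  integral_neg_of_even (fun s => by rw [modelS_neg, neg_sq]) t

@[simp] theorem modelT_zero (κ : ℝ) : modelT κ 0 = 0 := by simp [modelT]

theorem monotone_modelT (κ : ℝ) : Monotone (modelT κ) :=
  monotone_of_deriv_nonneg (fun t => (hasDerivAt_modelT κ t).differentiableAt) fun t => by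
    rw [(hasDerivAt_modelT κ t).deriv]
    positivity

theorem modelT_lt {κ s t : ℝ} (ht : t ∈ modelInterval κ) (hs : 0 ≤ s) (hst : s < t) :
    modelT κ s < modelT κ t := by
  have hmono : StrictMonoOn (modelT κ) (Icc s t) := by
    refine strictMonoOn_of_deriv_pos (convex_Icc s t) (contDiff_modelT κ).continuous.continuousOn ?_
    intro y hy
    rw [interior_Icc] at hy
    rw [(hasDerivAt_modelT κ y).deriv]
    exact pow_pos (modelS_pos (mem_modelInterval_of_le ht (hs.trans hy.1.le) hy.2.le)
      (hs.trans_lt hy.1)) 2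
  exact hmono ⟨le_rfl, hst.le⟩ ⟨hst.le, le_rfl⟩ hst

/-- The solution by variation of constants of `f'' + κ f = q`, `f(0) = 0`, `f'(0) = 1`, where
`q` is chosen such that `ψ_f = -T / (m + T²)`. -/
def modelWarping (κ m t : ℝ) : ℝ :=
  modelS κ t * (1 + ∫ s in (0 : ℝ)..t,
    modelC κ s * (modelS κ s * (m - modelT κ s ^ 2) / (m + modelT κ s ^ 2) ^ 2)) -
  modelC κ t * (modelT κ t / (m + modelT κ t ^ 2))

section modelWarping

variable {κ m : ℝ}

theorem add_modelT_sq_pos (hm : 0 < m) (t : ℝ) : 0 < m + modelT κ t ^ 2 := by positivity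

theorem contDiff_forcing (hm : 0 < m) : ContDiff ℝ ∞ fun s =>
    modelC κ s * (modelS κ s * (m - modelT κ s ^ 2) / (m + modelT κ s ^ 2) ^ 2) :=
  (contDiff_modelC κ).mul (((contDiff_modelS κ).mul (contDiff_const.sub
    ((contDiff_modelT κ).pow 2))).div ((contDiff_const.add ((contDiff_modelT κ).pow 2)).pow 2)
    fun t => pow_ne_zero 2 (add_modelT_sq_pos hm t).ne')

theorem contDiff_modelT_div (hm : 0 < m) :
    ContDiff ℝ ∞ fun t => modelT κ t / (m + modelT κ t ^ 2) :=
  (contDiff_modelT κ).div (contDiff_const.add ((contDiff_modelT κ).pow 2))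
    fun t => (add_modelT_sq_pos hm t).ne'

theorem contDiff_modelWarping (hm : 0 < m) : ContDiff ℝ ∞ (modelWarping κ m) :=
  ((contDiff_modelS κ).mul (contDiff_const.add (contDiff_integral (contDiff_forcing hm)))).sub
    ((contDiff_modelC κ).mul (contDiff_modelT_div hm))

theorem modelWarping_neg (t : ℝ) : modelWarping κ m (-t) = -modelWarping κ m t := by
  simp only [modelWarping]
  rw [integral_neg_of_odd (fun s => by simp only [modelC_neg, modelS_neg, modelT_neg]; ring),
    modelS_neg, modelC_neg, modelT_neg]
  ring

theorem hasDerivAt_modelT_div (hm : 0 < m) (t : ℝ) :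
    HasDerivAt (fun t => modelT κ t / (m + modelT κ t ^ 2))
      (modelS κ t ^ 2 * (m - modelT κ t ^ 2) / (m + modelT κ t ^ 2) ^ 2) t := by
  have hT := hasDerivAt_modelT κ t
  refine (hT.div ((hT.pow 2).const_add m) (add_modelT_sq_pos hm t).ne').congr_deriv ?_
  simp only [Pi.pow_apply]
  push_cast
  ring

theorem hasDerivAt_modelWarping (hm : 0 < m) (t : ℝ) : HasDerivAt (modelWarping κ m)
    (modelC κ t * (1 + ∫ s in (0 : ℝ)..t,
      modelC κ s * (modelS κ s * (m - modelT κ s ^ 2) / (m + modelT κ s ^ 2) ^ 2)) +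
    κ * modelS κ t * (modelT κ t / (m + modelT κ t ^ 2))) t := by
  have h := ((hasDerivAt_modelS κ t).mul
    ((hasDerivAt_integral (contDiff_forcing (κ := κ) hm).continuous t).const_add 1)).sub
    ((hasDerivAt_modelC κ t).mul (hasDerivAt_modelT_div (κ := κ) hm t))
  refine HasDerivAt.congr_deriv h ?_
  ring

theorem modelWarping_zero : modelWarping κ m 0 = 0 := by simp [modelWarping]

theorem deriv_modelWarping_zero (hm : 0 < m) : deriv (modelWarping κ m) 0 = 1 := by
  rw [(hasDerivAt_modelWarping hm 0).deriv]
  simp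

/-- `ψ_f = -T / (m + T²)`, by the identity `S_κ'² + κ S_κ² = 1`. -/
theorem comparisonFn_modelWarping (hm : 0 < m) : EqOn (comparisonFn κ (modelWarping κ m))
    (fun t => -(modelT κ t / (m + modelT κ t ^ 2))) (modelInterval κ) := by
  intro t ht
  rw [comparisonFn, (hasDerivAt_modelWarping hm t).hasDerivWithinAt.derivWithin
    ((isStarDomain_modelInterval κ).uniqueDiffOn t ht), deriv_modelS, modelWarping]
  linear_combination (-(modelT κ t / (m + modelT κ t ^ 2))) * modelC_sq_add κ t

theorem modelT_nonneg {t : ℝ} (ht : 0 ≤ t) : 0 ≤ modelT κ t := by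
  simpa using monotone_modelT κ ht

/-- The derivative of `-T / (m + T²)` is `S_κ² (T² - m) / (m + T²)²`. -/
theorem isAdmissible_neg_modelT_div {t₀ : ℝ} (h0 : 0 < t₀) (ht₀ : t₀ ∈ modelInterval κ) :
    IsAdmissible κ t₀ fun t => -(modelT κ t / (modelT κ t₀ ^ 2 + modelT κ t ^ 2)) := by
  have hT0 : 0 < modelT κ t₀ := by simpa using modelT_lt ht₀ le_rfl h0
  have hm : 0 < modelT κ t₀ ^ 2 := pow_pos hT0 2
  have hd : ∀ t ∈ modelInterval κ, derivWithin
      (fun t => -(modelT κ t / (modelT κ t₀ ^ 2 + modelT κ t ^ 2))) (modelInterval κ) t =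
      -(modelS κ t ^ 2 * (modelT κ t₀ ^ 2 - modelT κ t ^ 2) /
        (modelT κ t₀ ^ 2 + modelT κ t ^ 2) ^ 2) := fun t ht =>
    (hasDerivAt_modelT_div hm t).neg.hasDerivWithinAt.derivWithin
      ((isStarDomain_modelInterval κ).uniqueDiffOn t ht)
  refine ⟨(contDiff_modelT_div hm).neg.contDiffOn, by simp, ?_, fun t ht => ?_, fun t ht htt => ?_⟩
  · rw [hd 0 (zero_mem_modelInterval κ)]
    simp
  · exact neg_nonpos.2 (div_nonneg (modelT_nonneg ht.1) (add_modelT_sq_pos hm t).le)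
  · rw [hd t ht, neg_pos]
    have h1 := modelT_lt ht h0.le htt
    have h2 : modelT κ t₀ ^ 2 - modelT κ t ^ 2 < 0 := by nlinarith
    have h3 := modelS_pos ht (h0.trans htt)
    exact div_neg_of_neg_of_pos (mul_neg_of_pos_of_neg (pow_pos h3 2) h2)
      (pow_pos (add_modelT_sq_pos hm t) 2)

end modelWarping

theorem derivWithin_modelInterval_of_differentiableAt {κ t : ℝ} {f : ℝ → ℝ}
    (hf : DifferentiableAt ℝ f t) (ht : t ∈ modelInterval κ) :
    derivWithin f (modelInterval κ) t = deriv f t :=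
  hf.derivWithin ((isStarDomain_modelInterval κ).uniqueDiffOn t ht)

/-- Beyond the end of the model interval, an odd function can be changed to be positive. -/
theorem exists_odd_pos_extension {κ : ℝ} {f : ℝ → ℝ} (hf : ContDiff ℝ ∞ f)
    (hodd : ∀ t, f (-t) = -f t) (hpos : ∀ t ∈ modelInterval κ, 0 < t → 0 < f t)
    (hend : 0 < κ → 0 < f (Real.pi / √κ)) :
    ∃ g : ℝ → ℝ, ContDiff ℝ ∞ g ∧ (∀ t, g (-t) = -g t) ∧ (∀ t, 0 < t → 0 < g t) ∧
      EqOn g f (modelInterval κ) := by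
  rcases le_or_gt κ 0 with hκ | hκ
  · exact ⟨f, hf, hodd, fun t ht => hpos t (mem_modelInterval_of_nonpos hκ ht.le) ht,
      fun _ _ => rfl⟩
  set a := Real.pi / √κ with ha
  have ha0 : 0 < a := div_pos Real.pi_pos (Real.sqrt_pos.2 hκ)
  obtain ⟨δ, hδ, hball⟩ := Metric.eventually_nhds_iff.1
    (hf.continuous.continuousAt.eventually_const_lt (hend hκ))
  have hpos' : ∀ t, 0 < t → t < a + δ → 0 < f t := by
    intro t ht0 ht
    rcases lt_or_ge t a with h | h
    · exact hpos t ((mem_modelInterval_iff_of_pos hκ).2 ⟨ht0.le, h⟩) ht0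
    · refine hball ?_
      rw [Real.dist_eq, abs_of_nonneg (by linarith)]
      linarith
  -- `χ` is `1` on the model interval and vanishes before `f` may lose its sign
  let χ : ContDiffBump (0 : ℝ) := ⟨a, a + δ, ha0, by linarith⟩
  refine ⟨fun t => χ t * f t + (1 - χ t) * t, ?_, fun t => ?_, fun t ht => ?_, fun t ht => ?_⟩
  · exact (χ.contDiff.mul hf).add ((contDiff_const.sub χ.contDiff).mul contDiff_id)
  · simp only [χ.neg, hodd]
    ring
  · rcases lt_or_ge t (a + δ) with h | h
    · have h1 := hpos' t ht h
      have h2 : 0 ≤ χ t := χ.nonneg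
      have h3 : χ t ≤ 1 := χ.le_one
      rcases h2.eq_or_lt with h4 | h4
      · simp only [← h4]
        linarith
      · have := mul_pos h4 h1
        have := mul_nonneg (sub_nonneg.2 h3) ht.le
        linarith
    · have : χ t = 0 := χ.zero_of_le_dist (by
        rw [Real.dist_eq, sub_zero, abs_of_pos ht]
        exact h)
      simp only [this]
      linarith
  · have : χ t = 1 := χ.one_of_mem_closedBall (by
      rw [mem_closedBall_zero_iff, Real.norm_of_nonneg ht.1]
      exact ((mem_modelInterval_iff_of_pos hκ).1 ht).2.le)
    simp only [this]
    ring

theorem exists_warping_of_lt {κ t₀ : ℝ} (h0 : 0 < t₀) (ht₀ : t₀ ∈ modelInterval κ) :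
    ∃ f : ℝ → ℝ, ContDiff ℝ ∞ f ∧ (∀ t, f (-t) = -f t) ∧ deriv f 0 = 1 ∧
      (∀ t, 0 < t → 0 < f t) ∧ IsAdmissible κ t₀ (comparisonFn κ f) := by
  have hT0 : 0 < modelT κ t₀ := by simpa using modelT_lt ht₀ le_rfl h0
  have hm : 0 < modelT κ t₀ ^ 2 := pow_pos hT0 2
  have hadm := (isAdmissible_neg_modelT_div h0 ht₀).congr (comparisonFn_modelWarping hm)
  have hz := zero_mem_modelInterval κ
  have hsm := contDiff_modelWarping (κ := κ) hm
  have hd0 : derivWithin (modelWarping κ (modelT κ t₀ ^ 2)) (modelInterval κ) 0 = 1 := by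
    rw [derivWithin_modelInterval_of_differentiableAt
      (hasDerivAt_modelWarping hm 0).differentiableAt hz, deriv_modelWarping_zero hm]
  obtain ⟨f, hf, hodd, hpos, heq⟩ := exists_odd_pos_extension (κ := κ) hsm modelWarping_neg
    (fun t ht ht0 => by
      rw [eqOn_warpingOf_comparisonFn hsm.contDiffOn modelWarping_zero hd0 ht]
      exact (modelS_pos ht ht0).trans_le (modelS_le_warpingOf hadm.nonpos ht))
    (fun hκ => by
      have hs : 0 < √κ := Real.sqrt_pos.2 hκ
      have h1 : √κ * (Real.pi / √κ) = Real.pi := by field_simp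
      have hle : t₀ ≤ Real.pi / √κ := ((mem_modelInterval_iff_of_pos hκ).1 ht₀).2.le
      have hT := hT0.trans_le (monotone_modelT κ hle)
      rw [modelWarping, modelS, modelC, if_neg hκ.not_gt, if_neg hκ.ne', if_neg hκ.not_gt,
        if_neg hκ.ne', h1, Real.sin_pi, Real.cos_pi]
      simp only [zero_div, zero_mul, zero_sub, neg_mul, one_mul, neg_neg]
      exact div_pos hT (add_modelT_sq_pos hm _))
  refine ⟨f, hf, hodd, ?_, hpos, hadm.congr (eqOn_comparisonFn heq)⟩
  rw [← derivWithin_modelInterval_of_differentiableAt (hf.differentiable (by simp) 0) hz,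
    derivWithin_congr heq (heq hz), hd0]

theorem isWarping_of_contDiff (κ : ℝ) {f : ℝ → ℝ} (hf : ContDiff ℝ ∞ f)
    (hodd : ∀ t, f (-t) = -f t) (h1 : deriv f 0 = 1) (hpos : ∀ t, 0 < t → 0 < f t) :
    IsWarping κ f where
  smooth := hf.contDiffOn
  zero := by
    have := hodd 0
    rw [neg_zero] at this
    linarith
  deriv_zero := by
    rw [derivWithin_modelInterval_of_differentiableAt (hf.differentiable (by simp) 0)
      (zero_mem_modelInterval κ), h1]
  pos t _ ht := hpos t ht

section comparison

variable {κ : ℝ} {f : ℝ → ℝ} {x : Euc n}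

theorem IsWarping.hasDerivAt (hf : IsWarping κ f) {t : ℝ} (ht : t ∈ modelInterval κ) (h0 : 0 < t) :
    HasDerivAt f (derivWithin f (modelInterval κ) t) t :=
  (hf.smooth.differentiableOn (by simp) t ht).hasDerivWithinAt.hasDerivAt
    (modelInterval_mem_nhds ht h0)

theorem IsWarping.sphereMeanCurvature_eq (hf : IsWarping κ f) (hx : x ∈ modelBall n κ)
    (hx0 : x ≠ 0) : sphereMeanCurvature (warpedMetric n f) x =
      ((n : ℝ) - 1) * (derivWithin f (modelInterval κ) ‖x‖ / f ‖x‖) :=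
  sphereMeanCurvature_warpedMetric hx0 (hf.hasDerivAt hx (norm_pos_iff.2 hx0)) (hf.ne_zero hx hx0)

theorem IsWarping.sectionalCurvature_eq (hf : IsWarping κ f) (hx : x ∈ modelBall n κ)
    (hx0 : x ≠ 0) {v : Euc n} (hv : v ≠ 0) (hrv : warpedMetric n f x (radialField x) v = 0) :
    sectionalCurvature (warpedMetric n f) x (radialField x) v =
      -derivWithin (derivWithin f (modelInterval κ)) (modelInterval κ) ‖x‖ / f ‖x‖ := by
  have h0 := norm_pos_iff.2 hx0
  have hn := modelInterval_mem_nhds hx h0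
  refine sectionalCurvature_warpedMetric (f₁ := derivWithin f (modelInterval κ)) hx0 ?_ ?_
    (hf.ne_zero hx hx0) hv hrv
  · filter_upwards [hn, Ioi_mem_nhds h0] with s hs hs0
    exact hf.hasDerivAt hs hs0
  · exact ((hf.smooth.derivWithin (isStarDomain_modelInterval κ).uniqueDiffOn (m := ∞)
      (by simp)).differentiableOn (by simp) _ hx).hasDerivWithinAt.hasDerivAt hn

theorem IsWarping.sectionalCurvature_le_iff (hf : IsWarping κ f) (hx : x ∈ modelBall n κ)
    (hx0 : x ≠ 0) {v : Euc n} (hv : v ≠ 0) (hrv : warpedMetric n f x (radialField x) v = 0) :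
    sectionalCurvature (warpedMetric n f) x (radialField x) v ≤ κ ↔
      derivWithin (comparisonFn κ f) (modelInterval κ) ‖x‖ ≤ 0 := by
  have h0 := norm_pos_iff.2 hx0
  have hS := modelS_pos hx h0
  rw [hf.sectionalCurvature_eq hx hx0 hv hrv, derivWithin_comparisonFn hf.smooth hx,
    div_le_iff₀ (hf.pos _ hx h0), neg_mul, neg_nonpos, mul_nonneg_iff_of_pos_left hS]
  constructor <;> intro h <;> linarith

theorem IsWarping.sphereMeanCurvature_model_le_iff (hn : 2 ≤ n) (hf : IsWarping κ f)
    (hx : x ∈ modelBall n κ) (hx0 : x ≠ 0) :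
    sphereMeanCurvature (warpedMetric n (modelS κ)) x ≤ sphereMeanCurvature (warpedMetric n f) x ↔
      comparisonFn κ f ‖x‖ ≤ 0 := by
  have h0 := norm_pos_iff.2 hx0
  have hn1 : (0 : ℝ) < (n : ℝ) - 1 := by
    have : (2 : ℝ) ≤ n := by exact_mod_cast hn
    linarith
  rw [(isWarping_modelS κ).sphereMeanCurvature_eq hx hx0, hf.sphereMeanCurvature_eq hx hx0,
    mul_le_mul_iff_right₀ hn1, div_le_div_iff₀ (modelS_pos hx h0) (hf.pos _ hx h0), comparisonFn,
    derivWithin_modelInterval_of_differentiableAt (hasDerivAt_modelS κ _).differentiableAt hx]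
  constructor <;> intro h <;> linarith

theorem IsWarping.lt_sectionalCurvature {t₀ : ℝ} (h0 : 0 < t₀) (hf : IsWarping κ f)
    (hadm : IsAdmissible κ t₀ (comparisonFn κ f)) (hx : x ∈ modelBall n κ) (ht : t₀ < ‖x‖)
    {v : Euc n} (hv : v ≠ 0) (hrv : warpedMetric n f x (radialField x) v = 0) :
    κ < sectionalCurvature (warpedMetric n f) x (radialField x) v := by
  have hx0 : x ≠ 0 := norm_pos_iff.1 (h0.trans ht)
  rw [← not_le, hf.sectionalCurvature_le_iff hx hx0 hv hrv, not_le]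
  exact hadm.deriv_pos _ hx ht

theorem IsWarping.not_forall_sectionalCurvature_le (hn : 2 ≤ n) {t₀ r : ℝ} (h0 : 0 < t₀)
    (ht₀ : t₀ ∈ modelInterval κ) (hf : IsWarping κ f)
    (hadm : IsAdmissible κ t₀ (comparisonFn κ f)) (hr : t₀ < r) :
    ¬ ∀ x : Euc n, ‖x‖ < r → ∀ u v : Euc n, LinearIndependent ℝ ![u, v] →
      sectionalCurvature (warpedMetric n f) x u v ≤ κ := by
  intro hall
  obtain ⟨b, hb, htb⟩ := exists_gt_mem_modelInterval ht₀
  obtain ⟨t, ht1, ht2⟩ := exists_between (lt_min htb hr)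
  have htpos : 0 < t := h0.trans ht1
  have htI := mem_modelInterval_of_le hb htpos.le (ht2.trans_le (min_le_left _ _)).le
  let i : Fin n := ⟨0, by omega⟩
  let j : Fin n := ⟨1, by omega⟩
  have hij : j ≠ i := by simp [i, j]
  have hnorm : ‖t • (stdVec i : Euc n)‖ = t := by
    simp [norm_smul, stdVec, abs_of_pos htpos]
  have hx0 : t • (stdVec i : Euc n) ≠ 0 := by
    rw [← norm_pos_iff, hnorm]
    exact htpos
  have hx : t • (stdVec i : Euc n) ∈ modelBall n κ := by
    rw [modelBall, mem_ofPred_eq, hnorm]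
    exact htI
  have hv : (stdVec j : Euc n) ≠ 0 := by simp [stdVec]
  have hin : inner ℝ (radialField (t • (stdVec i : Euc n))) (stdVec j) = (0 : ℝ) := by
    rw [inner_stdVec]
    simp [radialField, stdVec, hij]
  have hlt := hf.lt_sectionalCurvature h0 hadm hx (by rwa [hnorm]) hv
    (by rw [warpedMetric_radialField n f _ _ hx0, hin])
  refine absurd (hall _ (by rw [hnorm]; exact ht2.trans_le (min_le_right _ _)) _ _ ?_) hlt.not_ge
  rw [LinearIndependent.pair_iff]
  intro a b hab
  have h1 : a = 0 := by
    have := congrArg (fun z => inner ℝ (radialField (t • (stdVec i : Euc n))) z) hab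
    simpa [inner_add_right, real_inner_smul_right, hin, norm_radialField hx0] using this
  subst h1
  rw [zero_smul, zero_add] at hab
  exact ⟨rfl, (smul_eq_zero.1 hab).resolve_right hv⟩

end comparison

end

theorem mainTheorem6 (n : ℕ) (hn : 2 ≤ n) (κ : ℝ) :
    -- the model space
    (IsWarping κ (modelS κ) ∧ IsSmoothMetricOn (warpedMetric n (modelS κ)) (modelBall n κ) ∧
      ∀ x ∈ modelBall n κ, x ≠ 0 →
        sphereMeanCurvature (warpedMetric n (modelS κ)) x =
          ((n : ℝ) - 1) * (deriv (modelS κ) ‖x‖ / modelS κ ‖x‖)) ∧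
    -- every metric `dt² + f² dθ²` on the ball of radius `a_κ`
    (∀ f : ℝ → ℝ, IsWarping κ f →
      IsSmoothMetricOn (warpedMetric n f) (modelBall n κ \ {0}) ∧
      ContinuousOn (warpedMetric n f) (modelBall n κ) ∧
      (HasSmoothOddExtension κ f → IsSmoothMetricOn (warpedMetric n f) (modelBall n κ)) ∧
      (∀ x ∈ modelBall n κ,
        metricDist (warpedMetric n f) (modelBall n κ) 0 x = ENNReal.ofReal ‖x‖) ∧
      comparisonFn κ f 0 = 0 ∧
      derivWithin (comparisonFn κ f) (modelInterval κ) 0 = 0 ∧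
      EqOn f (warpingOf κ (comparisonFn κ f)) (modelInterval κ) ∧
      (∀ x ∈ modelBall n κ, x ≠ 0 →
        (∀ v : Euc n, v ≠ 0 → warpedMetric n f x (radialField x) v = 0 →
          (sectionalCurvature (warpedMetric n f) x (radialField x) v ≤ κ ↔
            derivWithin (comparisonFn κ f) (modelInterval κ) ‖x‖ ≤ 0)) ∧
        sphereMeanCurvature (warpedMetric n f) x =
          ((n : ℝ) - 1) * (derivWithin f (modelInterval κ) ‖x‖ / f ‖x‖) ∧
        (sphereMeanCurvature (warpedMetric n (modelS κ)) x ≤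
            sphereMeanCurvature (warpedMetric n f) x ↔
          comparisonFn κ f ‖x‖ ≤ 0))) ∧
    -- the metrics built from a prescribed `ψ`
    (∀ t₀ : ℝ, 0 < t₀ → ∀ ψ : ℝ → ℝ, IsAdmissible κ t₀ ψ →
      (∀ t ∈ modelInterval κ,
        IntervalIntegrable (fun s => ψ s / modelS κ s ^ 2) volume 0 t) ∧
      IsWarping κ (warpingOf κ ψ) ∧
      EqOn (comparisonFn κ (warpingOf κ ψ)) ψ (modelInterval κ) ∧
      (HasSmoothOddExtension κ ψ →
        IsSmoothMetricOn (warpedMetric n (warpingOf κ ψ)) (modelBall n κ)) ∧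
      (∀ x ∈ modelBall n κ, t₀ < ‖x‖ →
        ∀ v : Euc n, v ≠ 0 → warpedMetric n (warpingOf κ ψ) x (radialField x) v = 0 →
          κ < sectionalCurvature (warpedMetric n (warpingOf κ ψ)) x (radialField x) v) ∧
      (∀ x ∈ modelBall n κ, x ≠ 0 →
        sphereMeanCurvature (warpedMetric n (modelS κ)) x ≤
          sphereMeanCurvature (warpedMetric n (warpingOf κ ψ)) x)) ∧
    -- existence: complete smooth metrics on `ℝⁿ`
    (∀ t₀ ∈ modelInterval κ, 0 < t₀ → ∃ f : ℝ → ℝ,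
      ContDiff ℝ ∞ f ∧ (∀ t, f (-t) = -f t) ∧ deriv f 0 = 1 ∧ (∀ t, 0 < t → 0 < f t) ∧
      IsAdmissible κ t₀ (comparisonFn κ f) ∧
      IsSmoothMetricOn (warpedMetric n f) univ ∧
      IsCompleteMetric (warpedMetric n f) ∧
      (∀ x : Euc n, metricDist (warpedMetric n f) univ 0 x = ENNReal.ofReal ‖x‖) ∧
      (∀ x ∈ modelBall n κ, t₀ < ‖x‖ →
        ∀ v : Euc n, v ≠ 0 → warpedMetric n f x (radialField x) v = 0 →
          κ < sectionalCurvature (warpedMetric n f) x (radialField x) v) ∧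
      (∀ x ∈ modelBall n κ, x ≠ 0 →
        sphereMeanCurvature (warpedMetric n (modelS κ)) x ≤
          sphereMeanCurvature (warpedMetric n f) x) ∧
      -- the upper curvature bound fails on every ball of radius `r > t₀`
      (∀ r : ℝ, t₀ < r → ¬ ∀ x : Euc n, ‖x‖ < r → ∀ u v : Euc n, LinearIndependent ℝ ![u, v] →
        sectionalCurvature (warpedMetric n f) x u v ≤ κ)) := by
  refine ⟨⟨isWarping_modelS κ, ?_, fun x hx hx0 => ?_⟩, fun f hf => ⟨isSmoothMetricOn_diff hf,
    continuousOn_warpedMetric hf, isSmoothMetricOn_of_hasSmoothOddExtension hf,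
    fun x hx => metricDist_zero_left f hx, comparisonFn_zero hf.zero,
    derivWithin_comparisonFn_zero hf.smooth,
    eqOn_warpingOf_comparisonFn hf.smooth hf.zero hf.deriv_zero, fun x hx hx0 =>
    ⟨fun v hv hrv => hf.sectionalCurvature_le_iff hx hx0 hv hrv, hf.sphereMeanCurvature_eq hx hx0,
      hf.sphereMeanCurvature_model_le_iff hn hx hx0⟩⟩, fun t₀ ht₀ ψ hψ => ?_, fun t₀ ht₀ h0 => ?_⟩
  · exact isSmoothMetricOn_of_hasSmoothOddExtension (isWarping_modelS κ)
      (hasSmoothOddExtension_of_contDiff (contDiff_modelS κ) (modelS_neg κ))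
  · rw [(isWarping_modelS κ).sphereMeanCurvature_eq hx hx0,
      derivWithin_modelInterval_of_differentiableAt (hasDerivAt_modelS κ _).differentiableAt hx]
  · have hf := isWarping_warpingOf hψ.smooth hψ.zero hψ.deriv_zero hψ.nonpos
    have heq := comparisonFn_warpingOf hψ.smooth hψ.zero hψ.deriv_zero
    have hadm := hψ.congr heq
    refine ⟨fun t ht => intervalIntegrable_div_modelS_sq (isStarDomain_modelInterval κ)
      (modelInterval_subset_symmInterval κ) hψ.smooth hψ.zero hψ.deriv_zero ht, hf, heq,
      fun h => isSmoothMetricOn_of_hasSmoothOddExtension hf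
        (hasSmoothOddExtension_warpingOf h hψ.zero hψ.deriv_zero),
      fun x hx ht v hv hrv => hf.lt_sectionalCurvature ht₀ hadm hx ht hv hrv, fun x hx hx0 => ?_⟩
    exact (hf.sphereMeanCurvature_model_le_iff hn hx hx0).2 (hadm.nonpos _ hx)
  · obtain ⟨f, hf, hodd, h1, hpos, hadm⟩ := exists_warping_of_lt h0 ht₀
    have hκ := isWarping_of_contDiff κ hf hodd h1 hpos
    -- on all of `ℝⁿ` the metric is studied as one over the flat model ball
    have hz := isWarping_of_contDiff 0 hf hodd h1 hpos
    refine ⟨f, hf, hodd, h1, hpos, hadm, ?_, isCompleteMetric_warpedMetric hz, fun x => ?_,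
      fun x hx ht v hv hrv => hκ.lt_sectionalCurvature h0 hadm hx ht hv hrv,
      fun x hx hx0 => (hκ.sphereMeanCurvature_model_le_iff hn hx hx0).2 (hadm.nonpos _ hx),
      fun r hr => hκ.not_forall_sectionalCurvature_le hn h0 ht₀ hadm hr⟩
    · rw [← modelBall_zero n]
      exact isSmoothMetricOn_of_hasSmoothOddExtension hz
        (hasSmoothOddExtension_of_contDiff hf hodd)
    · rw [← modelBall_zero n]
      exact metricDist_zero_left f (by rw [modelBall_zero]; exact mem_univ x)
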